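/- **Theorem 1.2.** Let $G=\mathbb Z/2\times\mathbb Z/2$ and let $\mathcal F$ be the family of all cyclic subgroups of $G$. For a commutative ring $R$, a short exact sequence of $RG$-modules is called $\mathcal F$-split if its restriction to every $H\in\mathcal F$ splits over $RH$. An $RG$-module $P$ is called $\mathcal F$-projective if every $RG$-map $P\to C$ lifts along $B\to C$ for every $\mathcal F$-split short exact sequence $0\to A\to B\to C\to 0$. A relative $\mathcal F$-projective resolution of an $RG$-module $M$ is an exact sequence $\cdots\to P_1\xrightarrow{\partial_1}P_0\xrightarrow{\partial_0}M\to 0$ with all $P_n$ $\mathcal F$-projective and all sequences $0\to\ker\partial_n\to P_n\to\operatorname{im}\partial_n\to 0$ $\mathcal F$-split. Write $\mathcal FH^n(G,\mathbb F_2)=H^n(\operatorname{Hom}_{\mathbb F_2G}(P_*,\mathbb F_2))$, where $P_*$ is a relative $\mathcal F$-projective resolution of the trivial module $\mathbb F_2$ over $\mathbb F_2G$. Then: 1. A relative $\mathcal F$-projective resolution of $\mathbb F_2$ over $\mathbb F_2G$ exists, and for every choice of it $\mathcal FH^n(G,\mathbb F_2)$ is finite dimensional for all $n\ge 0$, with $$\dim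 \mathcal FH^0(G,\mathbb F_2)=1,\qquad \dim \mathcal FH^1(G,\mathbb F_2)=0,\qquad \dim \mathcal FH^n(G,\mathbb F_2)=2n-3\quad (n\ge 2).$$ 2. $\mathcal FH^*(G,\mathbb F_2)$ is not periodic: there are no $d>0$ and $N\ge 0$ such that $\mathcal FH^{n+d}(G,\mathbb F_2)\cong\mathcal FH^n(G,\mathbb F_2)$ for all $n\ge N$. 3. For a finite group $K$, let $\operatorname{rk}K$ denote the largest $r$ such that $K$ has a subgroup isomorphic to $(\mathbb Z/p)^r$ for some prime $p$. Then $\operatorname{rk}G=2$ and $\mathcal F=\{H\le G : \operatorname{rk}H\le 1\}$, and there is no exact sequence of $\mathbb ZG$-modules $$0\to\mathbb Z\to\mathbb ZX_n\to\cdots\to\mathbb ZX_1\to\mathbb ZX_0\to\mathbb Z\to 0$$ with $n\ge 0$ which is $\mathcal F$-split (i.e. for each of its maps $\partial$, with source $A$, the sequence $0\to\ker\partial\to A\to\operatorname{im}\partial\to 0$ is $\mathcal F$-split) and in which every $X_i$ is a $G$-set, finite or not, all of whose isotropy subgroups belong to $\mathcal F$. -/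

import Mathlib

open CategoryTheory CategoryTheory.Limits

universe u

namespace RelCohomology

/-- A family of subgroups of `G`: a set of subgroups closed under conjugation and under taking
subgroups, i.e. if `H` belongs to it and `g K g⁻¹ ≤ H`, then `K` belongs to it. -/
structure SubgroupFamily (G : Type u) [Group G] where
  /-- The members of the family. -/
  carrier : Set (Subgroup G)
  mem_of_conj_le : ∀ {H K : Subgroup G} (g : G), H ∈ carrier →
    K.map (MulAut.conj g).toMonoidHom ≤ H → K ∈ carrier

/-- The family of all cyclic subgroups of `G`. -/
def cyclicFamily (G : Type u) [Group G] : SubgroupFamily G where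
  carrier := {H | IsCyclic H}
  mem_of_conj_le := by
    intro H K g hH hK
    have : IsCyclic H := hH
    let f : K →* H := ((MulAut.conj g).toMonoidHom.comp K.subtype).codRestrict H
      (fun x => hK (Subgroup.mem_map_of_mem _ x.2))
    have hf : Function.Injective f := by
      intro x y hxy
      have h : (MulAut.conj g) (x : G) = (MulAut.conj g) (y : G) := congrArg Subtype.val hxy
      exact Subtype.ext ((MulAut.conj g).injective h)
    exact isCyclic_of_injective f hf

variable {k G : Type u} [CommRing k] [Group G]

/-- A sequence `0 ⟶ A ⟶ B ⟶ C ⟶ 0` of `kG`-modules is an `F`-split short exact sequence if it is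
short exact and, for every `H` in `F`, its restriction to `H` splits as a sequence of
`kH`-modules. -/
def IsFSplit (F : SubgroupFamily G) (S : ShortComplex (Rep.{u} k G)) : Prop :=
  S.ShortExact ∧ ∀ H ∈ F.carrier, Nonempty (S.map (Rep.resFunctor H.subtype)).Splitting

/-- A `kG`-module `P` is `F`-projective if every map from `P` to the end term of an `F`-split
short exact sequence lifts to the middle term. -/
def IsFProjective (F : SubgroupFamily G) (P : Rep.{u} k G) : Prop :=
  ∀ S : ShortComplex (Rep.{u} k G), IsFSplit F S →
    ∀ α : P ⟶ S.X₃, ∃ β : P ⟶ S.X₂, β ≫ S.g = α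

/-- The short exact sequence `0 ⟶ ker f ⟶ A ⟶ im f ⟶ 0` of a map `f : A ⟶ B`. -/
noncomputable def kernelImage {A B : Rep.{u} k G} (f : A ⟶ B) : ShortComplex (Rep.{u} k G) :=
  ShortComplex.mk (kernel.ι f) (factorThruImage f) (by
    rw [← cancel_mono (image.ι f), Category.assoc, image.fac, kernel.condition, zero_comp])

/-- A relative `F`-projective resolution `⋯ ⟶ P₂ ⟶ P₁ ⟶ P₀ ⟶ M ⟶ 0` of a `kG`-module `M`. -/
structure RelProjResolution (F : SubgroupFamily G) (M : Rep.{u} k G) where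
  /-- The complex `⋯ ⟶ P₂ ⟶ P₁ ⟶ P₀`. -/
  complex : ChainComplex (Rep.{u} k G) ℕ
  /-- The map `P₀ ⟶ M`. -/
  aug : complex.X 0 ⟶ M
  d_comp_aug : complex.d 1 0 ≫ aug = 0
  epi_aug : Epi aug
  exact_zero : (ShortComplex.mk (complex.d 1 0) aug d_comp_aug).Exact
  exact_succ : ∀ n, complex.ExactAt (n + 1)
  projective : ∀ n, IsFProjective F (complex.X n)
  split_aug : IsFSplit F (kernelImage aug)
  split_d : ∀ n, IsFSplit F (kernelImage (complex.d (n + 1) n))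

/-- The relative cohomology group `Hⁿ(Hom_{kG}(P, M))`, where `P` is a relative `F`-projective
resolution of the trivial module `k`. -/
noncomputable def relCohomology {F : SubgroupFamily G}
    (P : RelProjResolution F (Rep.trivial k G k)) (M : Rep.{u} k G) (n : ℕ) : ModuleCat.{u} k :=
  (P.complex.linearYonedaObj k M).homology n

/-- A sequence of `k`-modules is (eventually) periodic if for some `d > 0` its terms in degrees
`n` and `n + d` are isomorphic for all sufficiently large `n`. -/
def IsPeriodic (V : ℕ → ModuleCat.{u} k) : Prop :=
  ∃ d > 0, ∃ N, ∀ n ≥ N, Nonempty (V n ≅ V (n + d))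

/-- The rank of a finite group: the largest `r` such that, for some prime `p`, the group has a
subgroup isomorphic to `(ℤ/p)^r`. -/
noncomputable def groupRank (G : Type u) [Group G] : ℕ :=
  sSup {r | ∃ p : ℕ, p.Prime ∧ ∃ E : Subgroup G,
    Nonempty (E ≃* Multiplicative (Fin r → ZMod p))}

/-- There is an `F`-split exact sequence of `ℤG`-modules
`0 ⟶ ℤ ⟶ ℤXₙ ⟶ ⋯ ⟶ ℤX₁ ⟶ ℤX₀ ⟶ ℤ ⟶ 0`, for some `n ≥ 0` and some `G`-sets `Xᵢ` all of whose
isotropy subgroups are in `F`. The right-hand `ℤ` is in degree `0`, the module `ℤXᵢ` in degree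
`i + 1`, the left-hand `ℤ` in degree `n + 2`. -/
def HasPeriodicPermutationResolution {G : Type} [Group G] (F : SubgroupFamily G) : Prop :=
  ∃ (n : ℕ) (X : Fin (n + 1) → Type) (_ : ∀ i, MulAction G (X i))
    (C : ChainComplex (Rep.{0} ℤ G) ℕ),
    (∀ i (x : X i), MulAction.stabilizer G x ∈ F.carrier) ∧
    Nonempty (C.X 0 ≅ Rep.trivial ℤ G ℤ) ∧
    (∀ i : Fin (n + 1), Nonempty (C.X (i + 1) ≅ Rep.ofMulAction ℤ G (X i))) ∧
    Nonempty (C.X (n + 2) ≅ Rep.trivial ℤ G ℤ) ∧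
    (∀ m, n + 3 ≤ m → IsZero (C.X m)) ∧
    C.Acyclic ∧
    ∀ m, IsFSplit F (kernelImage (C.d (m + 1) m))

/-- The group `ℤ/2 × ℤ/2`, written multiplicatively. -/
abbrev KleinFour : Type := Multiplicative (ZMod 2) × Multiplicative (ZMod 2)

end RelCohomology

/-! ### Relative homological algebra: `F`-split sequences and the comparison theorem -/

namespace RelCohomology

variable {k G : Type u} [CommRing k] [Group G] {F : SubgroupFamily G}

/-! The three nontrivial characters of the Klein four-group `G` give three actions on the infinite
sphere with two cells in each dimension, where `ℤ/2` swaps the cells. `G` acts on the join of the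
three spheres. A nonempty cell has a stabilizer inside the kernel of some character, so the chain
modules are permutation modules with cyclic isotropy, hence `F`-projective
(`isFProjective_ofMulAction`). Conversely each cyclic subgroup lies in the kernel of some character
and fixes that sphere pointwise, so the contraction of that factor is equivariant and splits the
augmented complex (`contr_rep`, `bdry_contr`). Thus the chains of the join form a relative
resolution (`joinResolution`), and by the comparison theorem it computes the cohomology for every
choice.

An invariant cochain is a function of three degrees and, where all three are positive, of one
further bit. Modulo 2 the cocycle condition becomes a three-term recursion for traces, solvable from
arbitrary values on two of the coordinate planes. In cohomological degree `n + 1` these are `2(n +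
1)` values; coboundaries account for the image of a three-dimensional space (`singleValues`). That
map is onto for `n = 0` and injective for `n ≥ 1`, which gives the dimensions `0` and `2(n + 1) -
3`. The growth excludes periodicity.

A periodic permutation resolution over `ℤ` would become, after reduction mod 2, an `F`-split exact
sequence with `F`-projective middle terms. Dimension shifting along it would identify cohomology in
degree `n + 2`, of dimension `2n + 1`, with cohomology in degree `1`, which is zero. -/

lemma kernelImage_shortExact {A B : Rep.{u} k G} (f : A ⟶ B) : (kernelImage f).ShortExact where
  exact := by
    have h : (ShortComplex.mk (kernel.ι f) f (kernel.condition f)).Exact :=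
      ShortComplex.exact_of_f_is_kernel _ (kernelIsKernel f)
    let φ : kernelImage f ⟶ ShortComplex.mk (kernel.ι f) f (kernel.condition f) :=
      { τ₁ := 𝟙 _
        τ₂ := 𝟙 _
        τ₃ := image.ι f
        comm₁₂ := by simp [kernelImage]
        comm₂₃ := by simp [kernelImage] }
    have : Epi φ.τ₁ := inferInstanceAs (Epi (𝟙 _))
    have : IsIso φ.τ₂ := inferInstanceAs (IsIso (𝟙 _))
    have : Mono φ.τ₃ := inferInstanceAs (Mono (image.ι f))
    exact (ShortComplex.exact_iff_of_epi_of_isIso_of_mono φ).2 h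
  mono_f := inferInstanceAs (Mono (kernel.ι f))
  epi_g := inferInstanceAs (Epi (factorThruImage f))

/-- A short exact sequence is `F`-split as soon as its right-hand map has a section over each
member of `F`. -/
lemma isFSplit_of_section {S : ShortComplex (Rep.{u} k G)} (hS : S.ShortExact)
    (h : ∀ H ∈ F.carrier, ∃ s : Rep.res H.subtype S.X₃ ⟶ Rep.res H.subtype S.X₂,
      s ≫ Rep.resMap H.subtype S.g = 𝟙 _) : IsFSplit F S := by
  refine ⟨hS, fun H hH => ?_⟩
  obtain ⟨s, hs⟩ := h H hH
  have hS' : (S.map (Rep.resFunctor H.subtype)).ShortExact := (Rep.shortExact_res H.subtype).2 hS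
  exact ⟨ShortComplex.Splitting.ofExactOfSection _ hS'.exact s hs hS'.mono_f⟩

/-- If `f` has a generalised inverse over each member of `F`, then `0 ⟶ ker f ⟶ A ⟶ im f ⟶ 0` is
`F`-split. -/
lemma isFSplit_kernelImage {A B : Rep.{u} k G} (f : A ⟶ B)
    (h : ∀ H ∈ F.carrier, ∃ s : Rep.res H.subtype B ⟶ Rep.res H.subtype A,
      Rep.resMap H.subtype f ≫ s ≫ Rep.resMap H.subtype f = Rep.resMap H.subtype f) :
    IsFSplit F (kernelImage f) := by
  refine isFSplit_of_section (kernelImage_shortExact f) fun H hH => ?_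
  obtain ⟨s, hs⟩ := h H hH
  have hm : Function.Injective (image.ι f).hom := (Rep.mono_iff_injective _).1 inferInstance
  have he : Function.Surjective (factorThruImage f).hom :=
    (Rep.epi_iff_surjective _).1 inferInstance
  have hf (a : A) : (image.ι f).hom ((factorThruImage f).hom a) = f.hom a := by
    rw [← Rep.comp_apply, image.fac]
  refine ⟨Rep.resMap H.subtype (image.ι f) ≫ s, ?_⟩
  ext i
  obtain ⟨a, rfl⟩ := he i
  apply hm
  change (image.ι f).hom ((factorThruImage f).hom (s.hom ((image.ι f).hom _))) = _
  rw [hf, hf]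
  exact (ConcreteCategory.congr_hom hs a).trans (hf a).symm

lemma IsFProjective.of_iso {P Q : Rep.{u} k G} (hP : IsFProjective F P) (e : P ≅ Q) :
    IsFProjective F Q := fun S hS α => by
  obtain ⟨β, hβ⟩ := hP S hS (e.hom ≫ α)
  exact ⟨e.inv ≫ β, by rw [Category.assoc, hβ, Iso.inv_hom_id_assoc]⟩

lemma image_ι_comp_eq_zero (S : ShortComplex (Rep.{u} k G)) : image.ι S.f ≫ S.g = 0 := by
  rw [← cancel_epi (factorThruImage S.f), image.fac_assoc, S.zero, comp_zero]

/-- Replacing the first map by a monomorphism with the same image lets a map killed by `S.g` factor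
through that image, from where `F`-projectivity lifts it. -/
lemma exact_image_ι {S : ShortComplex (Rep.{u} k G)} (hS : S.Exact) :
    (ShortComplex.mk (image.ι S.f) S.g (image_ι_comp_eq_zero S)).Exact := by
  let T : ShortComplex (Rep.{u} k G) :=
    ShortComplex.mk (image.ι S.f) S.g (image_ι_comp_eq_zero S)
  let φ : S ⟶ T :=
    { τ₁ := factorThruImage S.f
      τ₂ := 𝟙 _
      τ₃ := 𝟙 _
      comm₁₂ := by simp [T]
      comm₂₃ := by simp [T] }
  have : Epi φ.τ₁ := inferInstanceAs (Epi (factorThruImage S.f))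
  have : IsIso φ.τ₂ := inferInstanceAs (IsIso (𝟙 _))
  have : Mono φ.τ₃ := inferInstanceAs (Mono (𝟙 _))
  exact (ShortComplex.exact_iff_of_epi_of_isIso_of_mono φ).1 hS

/-- Maps out of an `F`-projective module lift along the first map of an exact sequence
`X ⟶ Y ⟶ Z` whose kernel-image sequence is `F`-split. -/
lemma IsFProjective.exists_lift {P : Rep.{u} k G} (hP : IsFProjective F P)
    {S : ShortComplex (Rep.{u} k G)} (hS : S.Exact) (hf : IsFSplit F (kernelImage S.f))
    (α : P ⟶ S.X₂) (hα : α ≫ S.g = 0) : ∃ β : P ⟶ S.X₁, β ≫ S.f = α := by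
  have hT := exact_image_ι hS
  have : Mono (ShortComplex.mk (image.ι S.f) S.g (image_ι_comp_eq_zero S)).f :=
    inferInstanceAs (Mono (image.ι S.f))
  obtain ⟨β, hβ⟩ : ∃ β : P ⟶ S.X₁, β ≫ factorThruImage S.f = hT.lift α hα := hP _ hf _
  have h : (β ≫ factorThruImage S.f) ≫ image.ι S.f = α := by
    rw [hβ]
    exact hT.lift_f α hα
  exact ⟨β, by rwa [Category.assoc, image.fac] at h⟩

namespace RelProjResolution

variable {M N : Rep.{u} k G}

lemma exact_sc' (Q : RelProjResolution F M) (n : ℕ) :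
    (ShortComplex.mk (Q.complex.d (n + 2) (n + 1)) (Q.complex.d (n + 1) n)
      (Q.complex.d_comp_d _ _ _)).Exact :=
  (HomologicalComplex.exactAt_iff' _ (n + 2) (n + 1) n (by simp) (by simp)).1 (Q.exact_succ n)

lemma exists_lift_zero (P : RelProjResolution F N) (Q : RelProjResolution F M) (n : ℕ)
    (α : P.complex.X n ⟶ Q.complex.X 0) (hα : α ≫ Q.aug = 0) :
    ∃ β : P.complex.X n ⟶ Q.complex.X 1, β ≫ Q.complex.d 1 0 = α :=
  (P.projective n).exists_lift Q.exact_zero (Q.split_d 0) α hα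

lemma exists_lift_succ (P : RelProjResolution F N) (Q : RelProjResolution F M) (n m : ℕ)
    (α : P.complex.X n ⟶ Q.complex.X (m + 1)) (hα : α ≫ Q.complex.d (m + 1) m = 0) :
    ∃ β : P.complex.X n ⟶ Q.complex.X (m + 2), β ≫ Q.complex.d (m + 2) (m + 1) = α :=
  (P.projective n).exists_lift (Q.exact_sc' m) (Q.split_d (m + 1)) α hα

lemma exists_lift_aug (P : RelProjResolution F N) (Q : RelProjResolution F M) (n : ℕ)
    (α : P.complex.X n ⟶ M) : ∃ β : P.complex.X n ⟶ Q.complex.X 0, β ≫ Q.aug = α := by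
  have := Q.epi_aug
  -- Surjectivity of the augmentation is recast as exactness before a zero map, so that the same
  -- lifting lemma applies.
  exact (P.projective n).exists_lift
    ((ShortComplex.exact_iff_epi (ShortComplex.mk Q.aug (0 : M ⟶ M) comp_zero) rfl).2 ‹_›)
    Q.split_aug α comp_zero

/-- The comparison theorem: existence. -/
lemma exists_chainMap (P Q : RelProjResolution F M) :
    ∃ φ : P.complex ⟶ Q.complex, φ.f 0 ≫ Q.aug = P.aug := by
  obtain ⟨f₀, h₀⟩ := P.exists_lift_aug Q 0 P.aug
  obtain ⟨f₁, h₁⟩ := P.exists_lift_zero Q 1 (P.complex.d 1 0 ≫ f₀)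
    (by rw [Category.assoc, h₀, P.d_comp_aug])
  refine ⟨ChainComplex.mkHom _ _ f₀ f₁ h₁ fun n p => ?_, h₀⟩
  have h := P.exists_lift_succ Q (n + 2) n (P.complex.d (n + 2) (n + 1) ≫ p.2.1) (by
    rw [Category.assoc, p.2.2, HomologicalComplex.d_comp_d_assoc, zero_comp])
  exact ⟨h.choose, h.choose_spec⟩

/-- The comparison theorem: uniqueness up to homotopy. -/
lemma nonempty_homotopy_zero (P Q : RelProjResolution F M) (φ : P.complex ⟶ Q.complex)
    (hφ : φ.f 0 ≫ Q.aug = 0) : Nonempty (Homotopy φ 0) := by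
  obtain ⟨h₀, w₀⟩ := P.exists_lift_zero Q 0 (φ.f 0) hφ
  obtain ⟨h₁, w₁⟩ := P.exists_lift_succ Q 1 0 (φ.f 1 - P.complex.d 1 0 ≫ h₀)
    (by rw [Preadditive.sub_comp, Category.assoc, φ.comm, w₀, sub_self])
  refine ⟨Homotopy.mkInductive _ h₀ w₀.symm h₁ (by rw [w₁]; abel) fun n p => ?_⟩
  have h := P.exists_lift_succ Q (n + 2) (n + 1)
    (φ.f (n + 2) - P.complex.d (n + 2) (n + 1) ≫ p.2.1) (by
      rw [Preadditive.sub_comp, φ.comm, Category.assoc]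
      nth_rw 1 [p.2.2]
      simp)
  exact ⟨h.choose, by rw [h.choose_spec]; abel⟩

lemma nonempty_homotopyEquiv (P Q : RelProjResolution F M) :
    Nonempty (HomotopyEquiv P.complex Q.complex) := by
  obtain ⟨φ, hφ⟩ := P.exists_chainMap Q
  obtain ⟨ψ, hψ⟩ := Q.exists_chainMap P
  obtain ⟨h⟩ := P.nonempty_homotopy_zero P (φ ≫ ψ - 𝟙 _) (by
    simp [Preadditive.sub_comp, hφ, hψ])
  obtain ⟨h'⟩ := Q.nonempty_homotopy_zero Q (ψ ≫ φ - 𝟙 _) (by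
    simp [Preadditive.sub_comp, hφ, hψ])
  exact ⟨⟨φ, ψ, Homotopy.equivSubZero.symm h, Homotopy.equivSubZero.symm h'⟩⟩

end RelProjResolution

/-- Homotopy equivalent complexes have isomorphic cohomology. -/
lemma nonempty_homology_iso {K L : ChainComplex (Rep.{u} k G) ℕ} (e : HomotopyEquiv K L)
    (M : Rep.{u} k G) (n : ℕ) :
    Nonempty ((K.linearYonedaObj k M).homology n ≅ (L.linearYonedaObj k M).homology n) := by
  -- The contravariant `Hom(-, M)` is made covariant with values in the opposite category, where
  -- functors preserve homotopy equivalences; homology is then brought back by `unop`.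
  let Φ := ((linearYoneda k (Rep.{u} k G)).obj M).rightOp
  let i := (Φ.mapHomotopyEquiv e).toHomologyIso n
  exact ⟨HomologicalComplex.homologyUnop _ _ ≪≫ i.unop.symm ≪≫
    (HomologicalComplex.homologyUnop _ _).symm⟩

/-- Cochains, as a linear map given by precomposition with a differential. -/
abbrev coboundaryMap (K : ChainComplex (Rep.{u} k G) ℕ) (M : Rep.{u} k G) (i j : ℕ) :
    (K.X i ⟶ M) →ₗ[k] (K.X j ⟶ M) :=
  Linear.leftComp k M (K.d j i)

end RelCohomology

/-! ### Permutation modules, dimension shifting, and homology as an explicit quotient -/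

namespace RelCohomology

variable {k G : Type u} [CommRing k] [Group G] {F : SubgroupFamily G}

/-- A permutation module all of whose isotropy groups belong to `F` is `F`-projective. -/
lemma isFProjective_ofMulAction (X : Type u) [MulAction G X]
    (hX : ∀ x : X, MulAction.stabilizer G x ∈ F.carrier) :
    IsFProjective F (Rep.ofMulAction k G X) := by
  intro S hS α
  -- The splitting over the stabilizer of `x` provides a lift of the image of `x` that this
  -- stabilizer fixes.
  have hb (x : X) : ∃ b : S.X₂, S.g.hom b = α.hom (.single x 1) ∧
      ∀ g ∈ MulAction.stabilizer G x, S.X₂.ρ g b = b := by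
    obtain ⟨s⟩ := hS.2 _ (hX x)
    refine ⟨s.s.hom (α.hom (.single x 1)), ConcreteCategory.congr_hom s.s_g _, fun g hg => ?_⟩
    have h := Rep.hom_comm_apply s.s ⟨g, hg⟩ (α.hom (.single x 1))
    refine h.symm.trans (congrArg s.s.hom ?_)
    refine (Rep.hom_comm_apply α g (.single x 1)).symm.trans ?_
    rw [Representation.ofMulAction_single, hg]
  choose b hgb hstab using hb
  let r (x : X) : X := (Quotient.mk (MulAction.orbitRel G X) x).out
  have hr (x : X) : ∃ g : G, g • r x = x :=
    MulAction.orbitRel_apply.1 ((MulAction.orbitRel G X).symm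
      (Quotient.mk_out (s := MulAction.orbitRel G X) x))
  choose t ht using hr
  have hrg (g : G) (x : X) : r (g • x) = r x := by
    have : Quotient.mk (MulAction.orbitRel G X) (g • x) = Quotient.mk _ x :=
      Quotient.sound (MulAction.orbitRel_apply.2 ⟨g, rfl⟩)
    simp only [r, this]
  -- The lift at an orbit representative is transported along the orbit; it does not depend on the
  -- transporting element because the stabilizer fixes it.
  let c (x : X) : S.X₂ := S.X₂.ρ (t x) (b (r x))
  have hc (g : G) (x : X) : c (g • x) = S.X₂.ρ g (c x) := by
    simp only [c, hrg]
    have h : (g * t x)⁻¹ * t (g • x) ∈ MulAction.stabilizer G (r x) := by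
      have h' := ht (g • x)
      rw [hrg] at h'
      rw [MulAction.mem_stabilizer_iff, mul_smul, h', inv_smul_eq_iff, mul_smul, ht]
    have h' := hstab _ _ h
    rw [map_mul, Module.End.mul_apply] at h'
    have h'' := congrArg (S.X₂.ρ (g * t x)) h'
    rw [Representation.self_inv_apply, map_mul, Module.End.mul_apply] at h''
    exact h''
  have hgc (x : X) : S.g.hom (c x) = α.hom (.single x 1) := by
    simp only [c]
    rw [Rep.hom_comm_apply, hgb, ← Rep.hom_comm_apply]
    change α.hom (Representation.ofMulAction k G X (t x) _) = _
    rw [Representation.ofMulAction_single, ht]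
  let β : Rep.ofMulAction k G X ⟶ S.X₂ := Rep.ofHom
    ⟨Finsupp.lift S.X₂ k X c ∘ₗ (MonoidAlgebra.coeffLinearEquiv _).toLinearMap, fun g => by
      ext x
      simp [hc]⟩
  refine ⟨β, ?_⟩
  ext x
  simp [β, hgc]

/-- If `f = e ≫ m` with `m` mono and `e` split epi over each member of `F`, then
`0 ⟶ ker f ⟶ A ⟶ im f ⟶ 0` is `F`-split. -/
lemma isFSplit_kernelImage_of_factorization {A I B : Rep.{u} k G} {f : A ⟶ B} {e : A ⟶ I}
    {m : I ⟶ B} [Epi e] [Mono m] (hf : e ≫ m = f)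
    (h : ∀ H ∈ F.carrier, ∃ s : Rep.res H.subtype I ⟶ Rep.res H.subtype A,
      s ≫ Rep.resMap H.subtype e = 𝟙 _) : IsFSplit F (kernelImage f) := by
  refine isFSplit_of_section (kernelImage_shortExact f) fun H hH => ?_
  obtain ⟨s, hs⟩ := h H hH
  let t : image f ⟶ I := image.lift ⟨I, m, e, hf⟩
  have htm : t ≫ m = image.ι f := image.lift_fac _
  have hte : factorThruImage f ≫ t = e := by
    rw [← cancel_mono m, Category.assoc, htm, image.fac, hf]
  have : Mono (t ≫ m) := by rw [htm]; infer_instance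
  have ht : Function.Injective t.hom := (Rep.mono_iff_injective _).1 (mono_of_mono t m)
  refine ⟨Rep.resMap H.subtype t ≫ s, ?_⟩
  ext i
  apply ht
  refine (ConcreteCategory.congr_hom hte (s.hom (t.hom i))).trans ?_
  exact ConcreteCategory.congr_hom hs (t.hom i)

lemma IsFSplit.exists_section {A B : Rep.{u} k G} {f : A ⟶ B} [Epi f]
    (hf : IsFSplit F (kernelImage f)) {H : Subgroup G} (hH : H ∈ F.carrier) :
    ∃ s : Rep.res H.subtype B ⟶ Rep.res H.subtype A, s ≫ Rep.resMap H.subtype f = 𝟙 _ := by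
  obtain ⟨s⟩ := hf.2 H hH
  have : Epi (image.ι f) := epi_of_epi_fac (image.fac f)
  have : IsIso (image.ι f) := isIso_of_mono_of_epi _
  refine ⟨Rep.resMap H.subtype (inv (image.ι f)) ≫ s.s, ?_⟩
  ext b
  refine (ConcreteCategory.congr_hom (image.fac f).symm _).trans ?_
  refine (congrArg (image.ι f).hom (ConcreteCategory.congr_hom s.s_g _)).trans ?_
  exact ConcreteCategory.congr_hom (IsIso.inv_hom_id (image.ι f)) b

/-- The dimension-shifting step for relative projective resolutions. -/
noncomputable def RelProjResolution.cons {S : ShortComplex (Rep.{u} k G)} (hS : IsFSplit F S)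
    (hP : IsFProjective F S.X₂) (Q : RelProjResolution F S.X₁) : RelProjResolution F S.X₃ := by
  have := Q.epi_aug
  have := hS.1.mono_f
  have h₁ : Q.complex.d 1 0 ≫ Q.aug ≫ S.f = 0 := by
    rw [← Category.assoc, Q.d_comp_aug, zero_comp]
  -- `S.X₂` goes in degree `0` and the resolution of `S.X₁` moves up by one.
  let K := Q.complex.augment (Q.aug ≫ S.f) h₁
  have split_comp : IsFSplit F (kernelImage (Q.aug ≫ S.f)) :=
    isFSplit_kernelImage_of_factorization rfl fun _ hH => Q.split_aug.exists_section hH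
  have split_g : IsFSplit F (kernelImage S.g) :=
    have := hS.1.epi_g
    isFSplit_kernelImage_of_factorization (Category.comp_id S.g) fun H hH =>
      (hS.2 H hH).elim fun s => ⟨s.s, s.s_g⟩
  exact
  { complex := K
    aug := S.g
    d_comp_aug := by
      change (Q.aug ≫ S.f) ≫ S.g = 0
      simp
    epi_aug := hS.1.epi_g
    exact_zero := by
      let φ : ShortComplex.mk (Q.aug ≫ S.f) S.g (by simp) ⟶ S :=
        { τ₁ := Q.aug
          τ₂ := 𝟙 _
          τ₃ := 𝟙 _ }
      have : Epi φ.τ₁ := inferInstanceAs (Epi Q.aug)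
      have : IsIso φ.τ₂ := inferInstanceAs (IsIso (𝟙 _))
      have : Mono φ.τ₃ := inferInstanceAs (Mono (𝟙 _))
      exact (ShortComplex.exact_iff_of_epi_of_isIso_of_mono φ).2 hS.1.exact
    exact_succ := fun n => by
      rw [HomologicalComplex.exactAt_iff' _ (n + 2) (n + 1) n (by simp) (by simp)]
      cases n with
      | zero =>
        let φ : ShortComplex.mk (Q.complex.d 1 0) Q.aug Q.d_comp_aug ⟶ K.sc' 2 1 0 :=
          { τ₁ := 𝟙 _
            τ₂ := 𝟙 _
            τ₃ := S.f
            comm₁₂ := by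
              change 𝟙 _ ≫ Q.complex.d 1 0 = Q.complex.d 1 0 ≫ 𝟙 _
              simp
            comm₂₃ := by
              change 𝟙 _ ≫ Q.aug ≫ S.f = Q.aug ≫ S.f
              simp }
        have : Epi φ.τ₁ := inferInstanceAs (Epi (𝟙 _))
        have : IsIso φ.τ₂ := inferInstanceAs (IsIso (𝟙 _))
        have : Mono φ.τ₃ := inferInstanceAs (Mono S.f)
        exact (ShortComplex.exact_iff_of_epi_of_isIso_of_mono φ).1 Q.exact_zero
      | succ n => exact Q.exact_sc' n
    projective := fun n => by
      cases n with
      | zero => exact hP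
      | succ n => exact Q.projective n
    split_aug := split_g
    split_d := fun n => by
      cases n with
      | zero => exact split_comp
      | succ n => exact Q.split_d n }

lemma RelProjResolution.nonempty_cons_homology_iso {S : ShortComplex (Rep.{u} k G)}
    (hS : IsFSplit F S) (hP : IsFProjective F S.X₂) (Q : RelProjResolution F S.X₁)
    (M : Rep.{u} k G) (n : ℕ) :
    Nonempty (((Q.cons hS hP).complex.linearYonedaObj k M).homology (n + 2) ≅
      (Q.complex.linearYonedaObj k M).homology (n + 1)) := by
  let A := (Q.cons hS hP).complex.linearYonedaObj k M
  let B := Q.complex.linearYonedaObj k M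
  have e₁ := A.homologyIsoSc' (n + 1) (n + 2) (n + 3) (by simp) (by simp)
  have e₂ := B.homologyIsoSc' n (n + 1) (n + 2) (by simp) (by simp)
  -- In positive degrees the augmented complex is by definition the old one shifted, so no
  -- isomorphism needs to be built. Degree `n + 1` on the right keeps away from the spliced
  -- differential.
  have e : (A.sc' (n + 1) (n + 2) (n + 3)).homology ≅ (B.sc' n (n + 1) (n + 2)).homology :=
    Iso.refl (B.sc' n (n + 1) (n + 2)).homology
  exact ⟨e₁ ≪≫ e ≪≫ e₂.symm⟩

lemma nonempty_homology_zero_equiv (K : ChainComplex (Rep.{u} k G) ℕ) (M : Rep.{u} k G) :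
    Nonempty ((K.linearYonedaObj k M).homology 0 ≃ₗ[k]
      LinearMap.ker (coboundaryMap K M 0 1)) := by
  let A := K.linearYonedaObj k M
  let S := A.sc' 0 0 1
  have e := A.homologyIsoSc' 0 0 1 (by simp) (by simp)
  -- At the end of the complex the index preceding `0` is `0` itself, with zero differential.
  have hf : S.f = 0 := A.shape 0 0 (by simp)
  have hb : LinearMap.range S.moduleCatToCycles = ⊥ := by
    rw [LinearMap.range_eq_bot]
    ext x
    exact congrArg (fun f : S.X₁ ⟶ S.X₂ => f.hom x) hf
  exact ⟨(e ≪≫ S.moduleCatHomologyIso).toLinearEquiv ≪≫ₗ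
    Submodule.quotEquivOfEqBot _ hb⟩

lemma nonempty_homology_succ_equiv (K : ChainComplex (Rep.{u} k G) ℕ) (M : Rep.{u} k G) (n : ℕ) :
    Nonempty ((K.linearYonedaObj k M).homology (n + 1) ≃ₗ[k]
      LinearMap.ker (coboundaryMap K M (n + 1) (n + 2)) ⧸
        (LinearMap.range (coboundaryMap K M n (n + 1))).submoduleOf
          (LinearMap.ker (coboundaryMap K M (n + 1) (n + 2)))) := by
  let A := K.linearYonedaObj k M
  let S := A.sc' n (n + 1) (n + 2)
  have e := A.homologyIsoSc' n (n + 1) (n + 2) (by simp) (by simp)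
  have hb : LinearMap.range S.moduleCatToCycles =
      (LinearMap.range S.f.hom).submoduleOf (LinearMap.ker S.g.hom) :=
    LinearMap.range_codRestrict _ _ _
  exact ⟨(e ≪≫ S.moduleCatHomologyIso).toLinearEquiv ≪≫ₗ
    Submodule.quotEquivOfEq _ _ hb⟩

end RelCohomology

/-! ### The join of three contractible complexes with `ℤ/2`-action -/

namespace RelCohomology

/-- The cells of the reduced standard resolution of `ℤ/2`: one cell in degree `0` and two cells in
each positive degree. -/
abbrev Cell : Type := Option (ℕ × ZMod 2)

lemma zmod_two_cases (x : ZMod 2) : x = 0 ∨ x = 1 := by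
  revert x; decide

namespace Cell

/-- Degree is dimension plus one: `none` plays the empty cell of the augmentation. With this shift
the tensor product of augmented complexes is the augmented complex of the join. -/
def deg : Cell → ℕ
  | none => 0
  | some (n, _) => n + 1

/-- The cells having a given cell in their boundary. -/
def up (a : Cell) (x : ZMod 2) : Cell := some (a.deg, x)

/-- The action of `ℤ/2` on cells. -/
def shift (x : ZMod 2) : Cell → Cell
  | none => none
  | some (n, y) => some (n, x + y)

@[simp] lemma deg_up (a : Cell) (x : ZMod 2) : (a.up x).deg = a.deg + 1 := rfl

@[simp] lemma up_up (a : Cell) (x y : ZMod 2) : (a.up x).up y = some (a.deg + 1, y) := rfl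

@[simp] lemma deg_shift (x : ZMod 2) (a : Cell) : (shift x a).deg = a.deg := by
  rcases a with _ | ⟨n, y⟩ <;> rfl

@[simp] lemma shift_zero (a : Cell) : shift 0 a = a := by
  rcases a with _ | ⟨n, y⟩ <;> simp [shift]

lemma shift_add (x y : ZMod 2) (a : Cell) : shift (x + y) a = shift x (shift y a) := by
  rcases a with _ | ⟨n, z⟩ <;> simp [shift, add_assoc]

lemma shift_up (x y : ZMod 2) (a : Cell) : shift x (a.up y) = a.up (x + y) := rfl

/-- The boundary of a chain, given by its coefficients. -/
def bd (f : Cell → ZMod 2) (a : Cell) : ZMod 2 := f (a.up 0) + f (a.up 1)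

/-- The standard contraction, given by coefficients. -/
def con (f : Cell → ZMod 2) : Cell → ZMod 2
  | none => 0
  | some (0, y) => if y = 0 then f none else 0
  | some (n + 1, y) => if y = 0 then f (some (n, 1)) else 0

lemma con_add (f g : Cell → ZMod 2) (a : Cell) :
    con (fun a => f a + g a) a = con f a + con g a := by
  rcases a with _ | ⟨_ | n, y⟩ <;> simp only [con, add_zero] <;> split_ifs <;> simp

lemma con_smul (r : ZMod 2) (f : Cell → ZMod 2) (a : Cell) :
    con (fun a => r * f a) a = r * con f a := by
  rcases a with _ | ⟨_ | n, y⟩ <;> simp [con]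

/-- `bd f a` depends only on the degree of `a`, so the two summands coincide and cancel mod 2. -/
lemma bd_bd (f : Cell → ZMod 2) (a : Cell) : bd (bd f) a = 0 := by
  simp only [bd, up_up]
  exact CharTwo.add_self_eq_zero _

lemma bd_con_comm (f : Cell → Cell → ZMod 2) (a b : Cell) :
    bd (fun b => con (fun a => f a b) a) b = con (fun a => bd (f a) b) a := by
  rcases a with _ | ⟨_ | n, y⟩ <;> simp only [bd, con, add_zero] <;> split_ifs <;> simp

/-- On basis cells `con` sends the empty cell to the vertex labelled `0`, a cell labelled `1` to the
next cell labelled `0`, and cells labelled `0` to zero. -/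
lemma bd_con_add_con_bd (f : Cell → ZMod 2) (a : Cell) : bd (con f) a + con (bd f) a = f a := by
  rcases a with _ | ⟨_ | n, y⟩
  · simp [bd, con, up, deg]
  · rcases zmod_two_cases y with rfl | rfl
    · simp only [bd, con, up, deg, one_ne_zero, if_true, if_false]
      linear_combination CharTwo.add_self_eq_zero (f (some (0, 1)))
    · simp [bd, con, up, deg]
  · rcases zmod_two_cases y with rfl | rfl
    · simp only [bd, con, up, deg, one_ne_zero, if_true, if_false]
      linear_combination CharTwo.add_self_eq_zero (f (some (n + 1, 1)))
    · simp [bd, con, up, deg]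

lemma bd_shift (f : Cell → ZMod 2) (x : ZMod 2) (a : Cell) :
    bd (fun a => f (shift x a)) a = bd f (shift x a) := by
  simp only [bd, shift_up]
  simp only [up, deg_shift]
  rcases zmod_two_cases x with rfl | rfl
  · simp
  · rw [show (1 + 1 : ZMod 2) = 0 from rfl, add_zero, add_comm]

lemma bd_eq_zero (f : Cell → ZMod 2) (a : Cell) (h : ∀ b, b.deg = a.deg + 1 → f b = 0) :
    bd f a = 0 := by
  simp [bd, h (a.up 0) rfl, h (a.up 1) rfl]

lemma con_eq_zero (f : Cell → ZMod 2) (a : Cell) (h : ∀ b, b.deg + 1 = a.deg → f b = 0) :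
    con f a = 0 := by
  rcases a with _ | ⟨_ | n, y⟩
  · rfl
  · simp [con, h none rfl]
  · simp [con, h (some (n, 1)) rfl]

end Cell

/-- Chains on triples of cells, given by their coefficients. -/
abbrev JoinChain : Type := Cell → Cell → Cell → ZMod 2

namespace JoinChain

open Cell

/-- The boundary map of the join. -/
def bdry : JoinChain →ₗ[ZMod 2] JoinChain where
  toFun f a b c := bd (fun a => f a b c) a + bd (fun b => f a b c) b + bd (f a b) c
  map_add' f g := by
    funext a b c
    simp only [Pi.add_apply, bd]; ring
  map_smul' r f := by
    funext a b c
    simp only [Pi.smul_apply, smul_eq_mul, bd, RingHom.id_apply]; ring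

lemma bdry_apply (f : JoinChain) (a b c : Cell) :
    bdry f a b c = bd (fun a => f a b c) a + bd (fun b => f a b c) b + bd (f a b) c := rfl

/-- Each mixed term arises from two orders of differentiation and cancels mod 2, so no signs are
needed. -/
lemma bdry_bdry (f : JoinChain) : bdry (bdry f) = 0 := by
  funext a b c
  have h₁ := bd_bd (fun a => f a b c) a
  have h₂ := bd_bd (fun b => f a b c) b
  have h₃ := bd_bd (f a b) c
  simp only [bdry_apply, bd, up_up] at *
  simp only [Pi.zero_apply]
  linear_combination h₁ + h₂ + h₃ + CharTwo.add_self_eq_zero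
    (f (a.up 0) (b.up 0) c + f (a.up 0) (b.up 1) c + f (a.up 1) (b.up 0) c + f (a.up 1) (b.up 1) c +
      f (a.up 0) b (c.up 0) + f (a.up 0) b (c.up 1) + f (a.up 1) b (c.up 0) + f (a.up 1) b (c.up 1) +
      f a (b.up 0) (c.up 0) + f a (b.up 0) (c.up 1) + f a (b.up 1) (c.up 0) + f a (b.up 1) (c.up 1))

/-- The contraction of the join coming from the `i`-th factor. -/
def contr : Fin 3 → JoinChain →ₗ[ZMod 2] JoinChain
  | 0 =>
    { toFun := fun f a b c => con (fun a => f a b c) a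
      map_add' := fun _ _ => by funext a b c; exact con_add _ _ _
      map_smul' := fun _ _ => by funext a b c; exact con_smul _ _ _ }
  | 1 =>
    { toFun := fun f a b c => con (fun b => f a b c) b
      map_add' := fun _ _ => by funext a b c; exact con_add _ _ _
      map_smul' := fun _ _ => by funext a b c; exact con_smul _ _ _ }
  | 2 =>
    { toFun := fun f a b c => con (f a b) c
      map_add' := fun _ _ => by funext a b c; exact con_add _ _ _
      map_smul' := fun _ _ => by funext a b c; exact con_smul _ _ _ }

/-- Contracting one factor contracts the join: the boundaries in the other two variables commute
with `con`, so their contributions occur twice. -/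
lemma bdry_contr (i : Fin 3) (f : JoinChain) : bdry (contr i f) + contr i (bdry f) = f := by
  funext a b c
  fin_cases i
  · change bd (con fun a => f a b c) a + bd (fun b => con (fun a => f a b c) a) b +
      bd (fun c => con (fun a => f a b c) a) c + con (fun a => bd (fun a => f a b c) a +
        bd (fun b => f a b c) b + bd (f a b) c) a = f a b c
    rw [con_add, con_add, bd_con_comm (fun a b => f a b c), bd_con_comm (fun a c => f a b c)]
    have h := bd_con_add_con_bd (fun a => f a b c) a
    linear_combination h + CharTwo.add_self_eq_zero
      (con (fun a => bd (fun b => f a b c) b) a + con (fun a => bd (f a b) c) a)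
  · change bd (fun a => con (fun b => f a b c) b) a + bd (con fun b => f a b c) b +
      bd (fun c => con (fun b => f a b c) b) c + con (fun b => bd (fun a => f a b c) a +
        bd (fun b => f a b c) b + bd (f a b) c) b = f a b c
    rw [con_add, con_add, bd_con_comm (fun b a => f a b c), bd_con_comm (fun b c => f a b c)]
    have h := bd_con_add_con_bd (fun b => f a b c) b
    linear_combination h + CharTwo.add_self_eq_zero
      (con (fun b => bd (fun a => f a b c) a) b + con (fun b => bd (f a b) c) b)
  · change bd (fun a => con (f a b) c) a + bd (fun b => con (f a b) c) b +
      bd (con (f a b)) c + con (fun c => bd (fun a => f a b c) a +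
        bd (fun b => f a b c) b + bd (f a b) c) c = f a b c
    rw [con_add, con_add, bd_con_comm (fun c a => f a b c), bd_con_comm (fun c b => f a b c)]
    have h := bd_con_add_con_bd (f a b) c
    linear_combination h + CharTwo.add_self_eq_zero
      (con (fun c => bd (fun a => f a b c) a) c + con (fun c => bd (fun b => f a b c) b) c)

end JoinChain

/-- The three nontrivial characters of the Klein four-group. -/
def kleinChar : Fin 3 → KleinFour → ZMod 2
  | 0, g => g.1.toAdd
  | 1, g => g.2.toAdd
  | 2, g => g.1.toAdd + g.2.toAdd

lemma kleinChar_mul (i : Fin 3) (g h : KleinFour) :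
    kleinChar i (g * h) = kleinChar i g + kleinChar i h := by
  fin_cases i
  · rfl
  · rfl
  · simp only [kleinChar, Prod.fst_mul, Prod.snd_mul, toAdd_mul]; ring

lemma kleinChar_one (i : Fin 3) : kleinChar i 1 = 0 := by
  fin_cases i <;> rfl

/-- Every cyclic subgroup of the Klein four-group is in the kernel of a nontrivial character. -/
lemma exists_kleinChar_eq_zero {H : Subgroup KleinFour} (hH : IsCyclic H) :
    ∃ i, ∀ h ∈ H, kleinChar i h = 0 := by
  obtain ⟨g, hg⟩ := (Subgroup.isCyclic_iff_exists_zpowers_eq_top H).1 hH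
  have key : ∀ g : KleinFour, ∃ i, kleinChar i g = 0 := by decide
  obtain ⟨i, hi⟩ := key g
  let φ : KleinFour →* Multiplicative (ZMod 2) :=
    { toFun := fun g => .ofAdd (kleinChar i g)
      map_one' := by rw [kleinChar_one]; rfl
      map_mul' := fun g h => by rw [kleinChar_mul]; rfl }
  have hle : H ≤ φ.ker := by
    rw [← hg, Subgroup.zpowers_le]
    exact congrArg Multiplicative.ofAdd hi
  exact ⟨i, fun h hh => congrArg Multiplicative.toAdd (MonoidHom.mem_ker.1 (hle hh))⟩

namespace JoinChain

open Cell

/-- The Klein four-group acts on the `i`-th factor of the join through its `i`-th character. -/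
def rep : Representation (ZMod 2) KleinFour JoinChain where
  toFun g :=
    { toFun := fun f a b c =>
        f (shift (kleinChar 0 g) a) (shift (kleinChar 1 g) b) (shift (kleinChar 2 g) c)
      map_add' := fun _ _ => rfl
      map_smul' := fun _ _ => rfl }
  map_one' := by ext f; simp [kleinChar_one]
  -- Precomposition is a left action here only because the group is commutative.
  map_mul' g h := by
    ext f a b c
    simp only [kleinChar_mul, add_comm (kleinChar _ g), shift_add]
    rfl

lemma rep_apply (g : KleinFour) (f : JoinChain) (a b c : Cell) : rep g f a b c =
    f (shift (kleinChar 0 g) a) (shift (kleinChar 1 g) b) (shift (kleinChar 2 g) c) := rfl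

lemma bdry_rep (g : KleinFour) (f : JoinChain) : bdry (rep g f) = rep g (bdry f) := by
  funext a b c
  simp only [bdry_apply, rep_apply]
  congr 1
  · congr 1
    · exact bd_shift (fun a => f a _ _) _ _
    · exact bd_shift (fun b => f _ b _) _ _
  · exact bd_shift (f _ _) _ _

/-- `con` prefers the label `0` and so is not equivariant under the swap. An element in the kernel
of the `i`-th character leaves that factor alone and moves only variables that `contr i` does not
see. -/
lemma contr_rep (i : Fin 3) (g : KleinFour) (hg : kleinChar i g = 0) (f : JoinChain) :
    contr i (rep g f) = rep g (contr i f) := by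
  funext a b c
  fin_cases i <;> rw [rep_apply]
  · simp_all [contr, rep_apply]
  · simp_all [contr, rep_apply]
  · change con (rep g f a b) c = con (f _ _) (shift (kleinChar 2 g) c)
    have hg' : kleinChar 2 g = 0 := hg
    rw [hg', shift_zero]
    congr 1
    funext c
    rw [rep_apply, hg', shift_zero]

/-- The chains of degree `n`. -/
def homog (n : ℕ) : Submodule (ZMod 2) JoinChain where
  carrier := {f | ∀ a b c, a.deg + b.deg + c.deg ≠ n → f a b c = 0}
  add_mem' hf hg a b c h := by simp [hf a b c h, hg a b c h]
  zero_mem' _ _ _ _ := rfl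
  smul_mem' r f hf a b c h := by simp [hf a b c h]

lemma rep_mem_homog (n : ℕ) (g : KleinFour) : homog n ≤ (homog n).comap (rep g) :=
  fun f hf a b c h => by
    rw [rep_apply]
    exact hf _ _ _ (by simpa using h)

lemma bdry_mem_homog {n : ℕ} {f : JoinChain} (hf : f ∈ homog (n + 1)) : bdry f ∈ homog n := by
  intro a b c h
  rw [bdry_apply, bd_eq_zero, bd_eq_zero, bd_eq_zero, add_zero, add_zero]
  all_goals
    intro x hx
    apply hf
    omega

lemma bdry_eq_zero {f : JoinChain} (hf : f ∈ homog 0) : bdry f = 0 := by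
  funext a b c
  rw [bdry_apply, bd_eq_zero, bd_eq_zero, bd_eq_zero, add_zero, add_zero]
  · rfl
  all_goals
    intro x hx
    apply hf
    omega

lemma contr_mem_homog (i : Fin 3) {n : ℕ} {f : JoinChain} (hf : f ∈ homog n) :
    contr i f ∈ homog (n + 1) := by
  intro a b c h
  fin_cases i
  · exact con_eq_zero (fun a => f a b c) a fun x hx => hf _ _ _ (by omega)
  · exact con_eq_zero (fun b => f a b c) b fun x hx => hf _ _ _ (by omega)
  · exact con_eq_zero (f a b) c fun x hx => hf _ _ _ (by omega)

end JoinChain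

open JoinChain

/-- The module of chains of degree `n` of the join. -/
abbrev joinRep (n : ℕ) : Rep (ZMod 2) KleinFour :=
  Rep.of (rep.subrepresentation (homog n) (rep_mem_homog n))

/-- The differential of the join. -/
def joinD (n : ℕ) : joinRep (n + 1) ⟶ joinRep n :=
  Rep.ofHom ⟨bdry.restrict fun _ => bdry_mem_homog, fun g => by
    ext f : 2
    exact bdry_rep g f⟩

/-- The augmentation of the join. -/
def joinAug : joinRep 1 ⟶ Rep.trivial (ZMod 2) KleinFour (ZMod 2) :=
  Rep.ofHom ⟨
    { toFun := fun f => bdry f.1 none none none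
      map_add' := fun f g => by simp
      map_smul' := fun r f => by simp }, fun g => by
    ext f
    change bdry (rep g f.1) none none none = bdry f.1 none none none
    rw [bdry_rep]
    rfl⟩

/-- The contraction of the join over a subgroup in the kernel of the `i`-th character. -/
def joinContr (i : Fin 3) {H : Subgroup KleinFour} (hH : ∀ h ∈ H, kleinChar i h = 0) (n : ℕ) :
    Rep.res H.subtype (joinRep n) ⟶ Rep.res H.subtype (joinRep (n + 1)) :=
  Rep.ofHom ⟨(contr i).restrict fun _ => contr_mem_homog i, fun g => by
    ext f : 2
    exact contr_rep i g (hH g g.2) f.1⟩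

lemma bdry_contr_bdry (i : Fin 3) (f : JoinChain) : bdry (contr i (bdry f)) = bdry f := by
  have h := bdry_contr i (bdry f)
  rwa [bdry_bdry, map_zero, add_zero] at h

lemma joinD_comp_joinD (n : ℕ) : joinD (n + 1) ≫ joinD n = 0 := by
  ext f : 3
  exact Subtype.ext (bdry_bdry f.1)

/-- The complex underlying the join resolution. -/
noncomputable def joinComplex : ChainComplex (Rep (ZMod 2) KleinFour) ℕ :=
  -- The shift drops `joinRep 0`, spanned by the triple of empty cells: this cell is fixed by all of
  -- `G` and represents the module being resolved.
  ChainComplex.of (fun n => joinRep (n + 1)) (fun n => joinD (n + 1))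
    (fun n => joinD_comp_joinD (n + 1))

lemma joinComplex_d (n : ℕ) : joinComplex.d (n + 1) n = joinD (n + 1) :=
  ChainComplex.of_d (fun n => joinRep (n + 1)) (fun n => joinD (n + 1)) n

lemma isFSplit_joinD (n : ℕ) :
    IsFSplit (cyclicFamily KleinFour) (kernelImage (joinD n)) := by
  refine isFSplit_kernelImage _ fun H hH => ?_
  obtain ⟨i, hi⟩ := exists_kleinChar_eq_zero hH
  refine ⟨joinContr i hi n, ?_⟩
  ext f : 3
  exact Subtype.ext (bdry_contr_bdry i f.1)

/-- The chain of degree `0` with a given coefficient. -/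
def vertexChain : ZMod 2 →ₗ[ZMod 2] homog 0 where
  toFun r := ⟨fun a b c => if a.deg + b.deg + c.deg = 0 then r else 0,
    fun a b c h => if_neg h⟩
  map_add' r s := by ext a b c; simp only [Submodule.coe_add, Pi.add_apply]; split_ifs <;> simp
  map_smul' r s := by ext a b c; simp

lemma contr_vertexChain (i : Fin 3) (r : ZMod 2) :
    bdry (contr i (vertexChain r).1) none none none = r := by
  have h := bdry_contr i (vertexChain r).1
  rw [bdry_eq_zero (vertexChain r).2, map_zero, add_zero] at h
  rw [h]
  rfl

lemma joinAug_surjective : Function.Surjective joinAug.hom := fun r =>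
  ⟨⟨contr 0 (vertexChain r).1, contr_mem_homog 0 (vertexChain r).2⟩, contr_vertexChain 0 r⟩

/-- A subgroup in the kernel of the `i`-th character fixes a vertex of the `i`-th factor. Coning off
the empty triple to that vertex gives the section. -/
lemma isFSplit_joinAug : IsFSplit (cyclicFamily KleinFour) (kernelImage joinAug) := by
  have := (Rep.epi_iff_surjective _).2 joinAug_surjective
  refine isFSplit_kernelImage_of_factorization (Category.comp_id _) fun H hH => ?_
  obtain ⟨i, hi⟩ := exists_kleinChar_eq_zero hH
  let v : Rep.res H.subtype (Rep.trivial (ZMod 2) KleinFour (ZMod 2)) ⟶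
      Rep.res H.subtype (joinRep 0) := Rep.ofHom ⟨vertexChain, fun g => by
    ext r a b
    change _ = (vertexChain _).1 _ _ _
    simp only [vertexChain]
    simp⟩
  refine ⟨v ≫ joinContr i hi 0, ?_⟩
  ext
  exact contr_vertexChain i _

lemma rep_exact_iff {k G : Type} [CommRing k] [Group G] (S : ShortComplex (Rep k G)) :
    S.Exact ↔ ∀ x : S.X₂, S.g.hom x = 0 → ∃ y : S.X₁, S.f.hom y = x := by
  rw [← ShortComplex.exact_map_iff_of_faithful S (forget₂ (Rep k G) (ModuleCat k)),
    ShortComplex.moduleCat_exact_iff]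
  rfl

lemma joinD_exact (n : ℕ) :
    (ShortComplex.mk (joinD (n + 1)) (joinD n) (joinD_comp_joinD n)).Exact := by
  rw [rep_exact_iff]
  intro f hf
  refine ⟨⟨contr 0 f.1, contr_mem_homog 0 f.2⟩, Subtype.ext ?_⟩
  have h := bdry_contr 0 f.1
  have hf' : bdry f.1 = 0 := congrArg Subtype.val hf
  rw [hf', map_zero, add_zero] at h
  exact h

lemma joinD_comp_joinAug : joinD 1 ≫ joinAug = 0 := by
  ext f
  exact congrFun (congrFun (congrFun (bdry_bdry f.1) none) none) none

lemma joinAug_exact :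
    (ShortComplex.mk (joinD 1) joinAug joinD_comp_joinAug).Exact := by
  rw [rep_exact_iff]
  intro f hf
  refine ⟨⟨contr 0 f.1, contr_mem_homog 0 f.2⟩, Subtype.ext ?_⟩
  have h := bdry_contr 0 f.1
  -- `bdry f` has degree `0`, so its only possibly nonzero coefficient is the augmentation of `f`.
  have hf' : bdry f.1 = 0 := by
    funext a b c
    by_cases habc : a.deg + b.deg + c.deg = 0
    · have key (a : Cell) (ha : a.deg = 0) : a = none := by
        rcases a with _ | ⟨n, y⟩
        · rfl
        · simp [Cell.deg] at ha
      rw [key a (by omega), key b (by omega), key c (by omega)]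
      exact hf
    · exact bdry_mem_homog f.2 a b c habc
  rw [hf', map_zero, add_zero] at h
  exact h

end RelCohomology

/-! ### The chains of the join as permutation modules with cyclic isotropy -/

namespace RelCohomology

open JoinChain

/-- The nontrivial element of the kernel of a nontrivial character. -/
def kleinKerGen : Fin 3 → KleinFour
  | 0 => (1, .ofAdd 1)
  | 1 => (.ofAdd 1, 1)
  | 2 => (.ofAdd 1, .ofAdd 1)

lemma isCyclic_of_kleinChar_eq_zero {H : Subgroup KleinFour} (i : Fin 3)
    (hH : ∀ h ∈ H, kleinChar i h = 0) : IsCyclic H := by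
  have key : ∀ i (h : KleinFour), kleinChar i h = 0 → h = 1 ∨ h = kleinKerGen i := by decide
  have hle : H ≤ Subgroup.zpowers (kleinKerGen i) := fun h hh => by
    rcases key i h (hH h hh) with rfl | rfl
    · exact one_mem _
    · exact Subgroup.mem_zpowers _
  exact isCyclic_of_injective (Subgroup.inclusion hle) (Subgroup.inclusion_injective hle)

/-- The action of the Klein four-group on triples of cells. -/
def actCell (g : KleinFour) (t : Cell × Cell × Cell) : Cell × Cell × Cell :=
  (t.1.shift (kleinChar 0 g), t.2.1.shift (kleinChar 1 g), t.2.2.shift (kleinChar 2 g))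

/-- The triples of cells of total degree `n`. -/
def JoinCell (n : ℕ) : Type :=
  {t : Cell × Cell × Cell // t.1.deg + t.2.1.deg + t.2.2.deg = n}

instance (n : ℕ) : MulAction KleinFour (JoinCell n) where
  smul g t := ⟨actCell g t.1, by simpa [actCell] using t.2⟩
  one_smul t := Subtype.ext (by
    change actCell 1 t.1 = t.1
    simp [actCell, kleinChar_one])
  mul_smul g h t := Subtype.ext (by
    change actCell (g * h) t.1 = actCell g (actCell h t.1)
    simp [actCell, kleinChar_mul, Cell.shift_add])

instance (n : ℕ) : Finite (JoinCell n) := by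
  have h : {a : Cell | a.deg ≤ n}.Finite := by
    refine ((((Set.finite_Iio n).prod (Set.finite_univ (α := ZMod 2))).image some).insert
      none).subset ?_
    rintro (_ | ⟨m, y⟩) ha
    · exact Set.mem_insert _ _
    · exact Set.mem_insert_of_mem _ ⟨(m, y), ⟨Set.mem_Iio.2 ha, Set.mem_univ _⟩, rfl⟩
  refine ((h.prod (h.prod h)).subset ?_).to_subtype
  rintro ⟨a, b, c⟩ (habc : _ + _ + _ = n)
  refine ⟨?_, ?_, ?_⟩ <;> simp only [Set.mem_ofPred_eq] at * <;> omega

/-- In positive total degree some coordinate is a nonempty cell. `ℤ/2` acts freely on such cells, so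
the stabilizer is killed by the corresponding character. -/
lemma stabilizer_joinCell (n : ℕ) (t : JoinCell (n + 1)) :
    MulAction.stabilizer KleinFour t ∈ (cyclicFamily KleinFour).carrier := by
  have key (x : ZMod 2) (a : Cell) (ha : a.deg ≠ 0) (h : a.shift x = a) : x = 0 := by
    rcases a with _ | ⟨n, y⟩
    · exact absurd rfl ha
    · simpa [Cell.shift] using h
  have hst (g : KleinFour) (hg : g ∈ MulAction.stabilizer KleinFour t) :
      actCell g t.1 = t.1 := congrArg Subtype.val hg
  simp only [actCell, Prod.ext_iff] at hst
  by_cases ha : t.1.1.deg = 0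
  · by_cases hb : t.1.2.1.deg = 0
    · refine isCyclic_of_kleinChar_eq_zero 2 fun g hg => key _ t.1.2.2 ?_ (hst g hg).2.2
      have := t.2
      omega
    · exact isCyclic_of_kleinChar_eq_zero 1 fun g hg => key _ t.1.2.1 hb (hst g hg).2.1
  · exact isCyclic_of_kleinChar_eq_zero 0 fun g hg => key _ t.1.1 ha (hst g hg).1

/-- The permutation module acts on coefficients through `g⁻¹`, `rep` through `g`; the two agree in a
group of exponent two. -/
lemma kleinFour_inv (g : KleinFour) : g⁻¹ = g := by
  revert g; decide

/-- The chain with given coefficients on the cells of degree `n`. -/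
def extendChain {n : ℕ} (v : JoinCell n → ZMod 2) : JoinChain := fun a b c =>
  if h : a.deg + b.deg + c.deg = n then v ⟨(a, b, c), h⟩ else 0

lemma extendChain_apply {n : ℕ} (v : JoinCell n → ZMod 2) {a b c : Cell}
    (h : a.deg + b.deg + c.deg = n) : extendChain v a b c = v ⟨(a, b, c), h⟩ := dif_pos h

lemma extendChain_of_ne {n : ℕ} (v : JoinCell n → ZMod 2) {a b c : Cell}
    (h : a.deg + b.deg + c.deg ≠ n) : extendChain v a b c = 0 := dif_neg h

lemma ext_homog {n : ℕ} {f g : homog n}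
    (h : ∀ a b c : Cell, a.deg + b.deg + c.deg = n → f.1 a b c = g.1 a b c) : f = g := by
  refine Subtype.ext ?_
  funext a b c
  by_cases habc : a.deg + b.deg + c.deg = n
  · exact h a b c habc
  · rw [f.2 a b c habc, g.2 a b c habc]

/-- The chains of degree `n` of the join are the functions on the cells of degree `n`. -/
noncomputable def homogEquiv (n : ℕ) :
    MonoidAlgebra (ZMod 2) (JoinCell n) ≃ₗ[ZMod 2] homog n where
  toFun v := ⟨extendChain v.coeff, fun _ _ _ h => extendChain_of_ne _ h⟩
  map_add' v w := ext_homog fun a b c h => by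
    change extendChain _ a b c = extendChain _ a b c + extendChain _ a b c
    simp only [extendChain_apply _ h]
    rfl
  map_smul' r v := ext_homog fun a b c h => by
    change extendChain _ a b c = r * extendChain _ a b c
    simp only [extendChain_apply _ h]
    rfl
  invFun f := .ofCoeff (Finsupp.equivFunOnFinite.symm
    fun t : JoinCell n => f.1 t.1.1 t.1.2.1 t.1.2.2)
  left_inv v := by
    ext t
    exact extendChain_apply v.coeff t.2
  right_inv f := ext_homog fun a b c h => extendChain_apply _ h

/-- The chains of degree `n` of the join form a permutation module. -/
noncomputable def joinRepIso (n : ℕ) :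
    Rep.ofMulAction (ZMod 2) KleinFour (JoinCell n) ≅ joinRep n :=
  Rep.mkIso (.mk (homogEquiv n) fun g => by
    refine LinearMap.ext fun v => ext_homog fun a b c h => ?_
    have h' : (a.shift (kleinChar 0 g)).deg + (b.shift (kleinChar 1 g)).deg +
        (c.shift (kleinChar 2 g)).deg = n := by simpa using h
    refine (extendChain_apply _ h).trans (Eq.trans ?_ (extendChain_apply v.coeff h').symm)
    refine (Representation.coeff_ofMulAction g v _).trans ?_
    rw [kleinFour_inv]
    rfl)

lemma isFProjective_joinRep (n : ℕ) :
    IsFProjective (cyclicFamily KleinFour) (joinRep (n + 1)) :=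
  (isFProjective_ofMulAction _ (stabilizer_joinCell n)).of_iso (joinRepIso (n + 1))

/-- The relative projective resolution of the trivial module given by the join. -/
noncomputable def joinResolution : RelProjResolution (cyclicFamily KleinFour)
    (Rep.trivial (ZMod 2) KleinFour (ZMod 2)) where
  complex := joinComplex
  aug := joinAug
  d_comp_aug := by
    rw [joinComplex_d]
    exact joinD_comp_joinAug
  epi_aug := (Rep.epi_iff_surjective _).2 joinAug_surjective
  exact_zero := by
    rw [rep_exact_iff]
    intro x hx
    obtain ⟨y, hy⟩ := (rep_exact_iff _).1 joinAug_exact x hx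
    refine ⟨y, ?_⟩
    change (joinComplex.d 1 0).hom y = x
    rw [joinComplex_d]
    exact hy
  exact_succ n := by
    rw [HomologicalComplex.exactAt_iff' _ (n + 2) (n + 1) n (by simp) (by simp), rep_exact_iff]
    intro x hx
    change (joinComplex.d (n + 1) n).hom x = 0 at hx
    rw [joinComplex_d] at hx
    obtain ⟨y, hy⟩ := (rep_exact_iff _).1 (joinD_exact (n + 1)) x hx
    refine ⟨y, ?_⟩
    change (joinComplex.d (n + 2) (n + 1)).hom y = x
    rw [joinComplex_d]
    exact hy
  projective n := isFProjective_joinRep n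
  split_aug := isFSplit_joinAug
  split_d n := by
    rw [joinComplex_d]
    exact isFSplit_joinD (n + 1)

end RelCohomology

/-! ### Cochains on the join as invariant functions on triples of cells -/

namespace RelCohomology

/-- The coboundary of a cochain on cells: the sum of its values on the faces. -/
def Cell.cobd {M : Type*} [AddCommGroup M] (c : Cell → M) : Cell → M
  | none => 0
  | some (0, _) => c none
  | some (n + 1, _) => c (some (n, 0)) + c (some (n, 1))

/-- The basis chain of a cell. -/
def Cell.basis (a : Cell) : Cell → ZMod 2 := fun x => if x = a then 1 else 0

namespace JoinChain

open Cell

/-- The coboundary on the join. -/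
def cobdry : JoinChain →ₗ[ZMod 2] JoinChain where
  toFun f a b c := cobd (fun a => f a b c) a + cobd (fun b => f a b c) b + cobd (f a b) c
  map_add' f g := by
    funext a b c
    rcases a with _ | ⟨_ | p, x⟩ <;> rcases b with _ | ⟨_ | q, y⟩ <;>
      rcases c with _ | ⟨_ | r, z⟩ <;> simp only [Pi.add_apply, cobd] <;> ring
  map_smul' s f := by
    funext a b c
    rcases a with _ | ⟨_ | p, x⟩ <;> rcases b with _ | ⟨_ | q, y⟩ <;>
      rcases c with _ | ⟨_ | r, z⟩ <;>
      simp only [Pi.smul_apply, smul_eq_mul, cobd, RingHom.id_apply] <;> ring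

/-- The basis chain of a triple of cells. -/
def basisChain (a b c : Cell) : JoinChain := fun x y z => basis a x * (basis b y * basis c z)

/-- The component of degree `n` of a chain. -/
def component (n : ℕ) : JoinChain →ₗ[ZMod 2] homog n where
  toFun f := ⟨fun a b c => if a.deg + b.deg + c.deg = n then f a b c else 0,
    fun _ _ _ h => if_neg h⟩
  map_add' f g := ext_homog fun a b c h => by simp [h]
  map_smul' r f := ext_homog fun a b c h => by simp [h]

lemma component_apply {n : ℕ} (f : JoinChain) {a b c : Cell} (h : a.deg + b.deg + c.deg = n) :
    (component n f).1 a b c = f a b c := if_pos h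

lemma component_bdry (n : ℕ) (f : JoinChain) :
    (component n (bdry f)).1 = bdry (component (n + 1) f).1 := by
  funext a b c
  by_cases h : a.deg + b.deg + c.deg = n
  · rw [component_apply _ h]
    simp only [bdry_apply, bd]
    iterate 6 rw [component_apply _ (by simp only [deg_up]; omega)]
  · rw [(component n _).2 a b c h, bdry_mem_homog (component (n + 1) f).2 a b c h]

lemma component_rep (n : ℕ) (g : KleinFour) (f : JoinChain) :
    (component n (rep g f)).1 = rep g (component n f).1 := by
  funext a b c
  by_cases h : a.deg + b.deg + c.deg = n
  · rw [component_apply _ h, rep_apply, rep_apply, component_apply _ (by simpa using h)]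
  · rw [(component n _).2 a b c h, rep_mem_homog n g (component n f).2 a b c h]

lemma component_basisChain {n : ℕ} {a b c : Cell} (h : a.deg + b.deg + c.deg ≠ n) :
    component n (basisChain a b c) = 0 := by
  refine ext_homog fun x y z hxyz => ?_
  rw [component_apply _ hxyz]
  change _ = (0 : ZMod 2)
  simp only [basisChain, basis]
  split_ifs with h₁ h₂ h₃ <;> simp_all

/-- The basis chain of a cell is mapped by the boundary to the sum of the faces. -/
lemma bd_basis (a x : Cell) : bd (basis a) x = cobd (fun a => basis a x) a := by
  rcases x with _ | ⟨n, w⟩ <;> rcases a with _ | ⟨_ | m, y⟩ <;>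
    simp only [bd, basis, up, deg, cobd, reduceCtorEq, if_false, Option.some.injEq, Prod.mk.injEq,
      add_zero, Nat.add_eq_zero_iff, one_ne_zero, and_false, false_and, if_true, true_and,
      Nat.add_right_cancel_iff]
  · rcases zmod_two_cases y with rfl | rfl <;> simp
  · by_cases h : n = m
    · subst h
      rcases zmod_two_cases y with rfl | rfl <;> rcases zmod_two_cases w with rfl | rfl <;> simp
    · simp [h]

lemma map_cobd {M N : Type*} [AddCommGroup M] [AddCommGroup N] (φ : M →+ N) (f : Cell → M)
    (a : Cell) : φ (cobd f a) = cobd (fun a => φ (f a)) a := by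
  rcases a with _ | ⟨_ | n, y⟩
  · exact map_zero φ
  · rfl
  · exact map_add φ _ _

/-- This is the transposition between `bd` on coefficients and `cobd` on indices, applied in each
factor by `bd_basis`. -/
lemma bdry_basisChain (a b c : Cell) : bdry (basisChain a b c) =
    cobd (fun a => basisChain a b c) a + cobd (fun b => basisChain a b c) b +
      cobd (fun c => basisChain a b c) c := by
  have h (f : Cell → JoinChain) (a x y z : Cell) :
      cobd f a x y z = cobd (fun a => f a x y z) a := by
    rcases a with _ | ⟨_ | n, y⟩ <;> rfl
  have hr (f : Cell → ZMod 2) (r : ZMod 2) (a : Cell) :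
      cobd (fun a => f a * r) a = cobd f a * r := (map_cobd (AddMonoidHom.mulRight r) f a).symm
  have hl (f : Cell → ZMod 2) (r : ZMod 2) (a : Cell) :
      cobd (fun a => r * f a) a = r * cobd f a := (map_cobd (AddMonoidHom.mulLeft r) f a).symm
  funext x y z
  have h₁ : cobd (fun a => basisChain a b c x y z) a =
      bd (basis a) x * (basis b y * basis c z) := by
    rw [bd_basis, ← hr]; rfl
  have h₂ : cobd (fun b => basisChain a b c x y z) b =
      basis a x * (bd (basis b) y * basis c z) := by
    rw [bd_basis, ← hr, ← hl]; rfl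
  have h₃ : cobd (fun c => basisChain a b c x y z) c =
      basis a x * (basis b y * bd (basis c) z) := by
    rw [bd_basis, ← hl, ← hl]; rfl
  refine Eq.trans ?_ (congrArg₂ (· + ·) (congrArg₂ (· + ·) ((h _ a x y z).trans h₁)
    ((h _ b x y z).trans h₂)) ((h _ c x y z).trans h₃)).symm
  simp only [bdry_apply, basisChain, bd]
  ring

variable (n : ℕ)

/-- The value of a cochain on the basis chains. -/
def cochainOfHom :
    (joinRep n ⟶ Rep.trivial (ZMod 2) KleinFour (ZMod 2)) →ₗ[ZMod 2] JoinChain where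
  toFun φ a b c := φ.hom (component n (basisChain a b c))
  map_add' _ _ := rfl
  map_smul' _ _ := rfl

variable {n}

lemma cochainOfHom_comp (φ : joinRep n ⟶ Rep.trivial (ZMod 2) KleinFour (ZMod 2)) :
    cochainOfHom (n + 1) (joinD n ≫ φ) = cobdry (cochainOfHom n φ) := by
  funext a b c
  let ψ : JoinChain →ₗ[ZMod 2] ZMod 2 := φ.hom.toLinearMap ∘ₗ component n
  have h : (joinD n).hom (component (n + 1) (basisChain a b c)) =
      component n (bdry (basisChain a b c)) := Subtype.ext (component_bdry n _).symm
  change φ.hom ((joinD n).hom (component (n + 1) (basisChain a b c))) = _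
  rw [h]
  change ψ (bdry (basisChain a b c)) = _
  rw [bdry_basisChain, map_add, map_add]
  exact congrArg₂ (· + ·) (congrArg₂ (· + ·) (map_cobd ψ.toAddMonoidHom _ a)
    (map_cobd ψ.toAddMonoidHom _ b)) (map_cobd ψ.toAddMonoidHom _ c)

lemma cochainOfHom_mem_homog (φ : joinRep n ⟶ Rep.trivial (ZMod 2) KleinFour (ZMod 2)) :
    cochainOfHom n φ ∈ homog n := fun a b c h => by
  change φ.hom (component n (basisChain a b c)) = 0
  rw [component_basisChain h, map_zero]

lemma shift_shift (x : ZMod 2) (a : Cell) : shift x (shift x a) = a := by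
  rw [← shift_add, CharTwo.add_self_eq_zero, shift_zero]

lemma rep_cochainOfHom (φ : joinRep n ⟶ Rep.trivial (ZMod 2) KleinFour (ZMod 2))
    (g : KleinFour) : rep g (cochainOfHom n φ) = cochainOfHom n φ := by
  funext a b c
  have h : component n (basisChain (shift (kleinChar 0 g) a) (shift (kleinChar 1 g) b)
      (shift (kleinChar 2 g) c)) = (joinRep n).ρ g (component n (basisChain a b c)) := by
    refine Subtype.ext (Eq.trans ?_ (component_rep n g _))
    congr 2
    funext x y z
    have hb (s : ZMod 2) (a x : Cell) : basis (shift s a) x = basis a (shift s x) := by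
      have : x = shift s a ↔ shift s x = a :=
        ⟨fun h => by rw [h, shift_shift], fun h => by rw [← h, shift_shift]⟩
      simp only [basis, this]
    simp only [rep_apply, basisChain, hb]
  refine (congrArg φ.hom h).trans ?_
  exact Rep.hom_comm_apply φ g _

lemma homogEquiv_single (t : JoinCell n) : homogEquiv n (.single t 1) =
    component n (basisChain t.1.1 t.1.2.1 t.1.2.2) := by
  refine ext_homog fun a b c h => ?_
  rw [component_apply _ h]
  refine (extendChain_apply _ h).trans ?_
  classical
  refine Finsupp.single_apply.trans ?_
  have h : t = ⟨(a, b, c), h⟩ ↔ a = t.1.1 ∧ b = t.1.2.1 ∧ c = t.1.2.2 := by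
    constructor
    · rintro rfl
      exact ⟨rfl, rfl, rfl⟩
    · rintro ⟨rfl, rfl, rfl⟩
      rfl
  simp only [h, basisChain, basis, ite_and, ite_mul, one_mul, zero_mul]

lemma cochainOfHom_injective : Function.Injective (cochainOfHom n) := by
  intro φ ψ h
  rw [← cancel_epi (joinRepIso n).hom]
  ext t
  change φ.hom (homogEquiv n (.single t 1)) = ψ.hom (homogEquiv n (.single t 1))
  rw [homogEquiv_single]
  exact congrFun (congrFun (congrFun h t.1.1) t.1.2.1) t.1.2.2

/-- Together with `cochainOfHom_injective` this identifies homomorphisms to the trivial module with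
invariant cochains, so the cohomology can be computed with functions alone. -/
lemma exists_cochainOfHom_eq {c : JoinChain} (hc : c ∈ homog n) (hG : ∀ g, rep g c = c) :
    ∃ φ, cochainOfHom n φ = c := by
  let v (t : JoinCell n) : ZMod 2 := c t.1.1 t.1.2.1 t.1.2.2
  have hv (g : KleinFour) (t : JoinCell n) : v (g • t) = v t :=
    congrFun (congrFun (congrFun (hG g) t.1.1) t.1.2.1) t.1.2.2
  let ψ : Rep.ofMulAction (ZMod 2) KleinFour (JoinCell n) ⟶
      Rep.trivial (ZMod 2) KleinFour (ZMod 2) := Rep.ofHom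
    ⟨Finsupp.lift (ZMod 2) (ZMod 2) (JoinCell n) v ∘ₗ
      (MonoidAlgebra.coeffLinearEquiv _).toLinearMap, fun g => by
      ext t
      simp [hv]⟩
  refine ⟨(joinRepIso n).inv ≫ ψ, ?_⟩
  have hmem := cochainOfHom_mem_homog ((joinRepIso n).inv ≫ ψ)
  have key : (⟨_, hmem⟩ : homog n) = ⟨c, hc⟩ := by
    refine ext_homog fun a b d h => ?_
    change ψ.hom ((homogEquiv n).symm (component n (basisChain a b d))) = c a b d
    have h' := homogEquiv_single (⟨(a, b, d), h⟩ : JoinCell n)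
    rw [show component n (basisChain a b d) = _ from h'.symm, LinearEquiv.symm_apply_apply]
    exact (Finsupp.sum_single_index (zero_mul _)).trans (one_mul _)
  exact congrArg Subtype.val key

end JoinChain

end RelCohomology

/-! ### Invariant cochains on orbits, and the coboundary as a recursion -/

namespace RelCohomology

namespace Cell

def label : Cell → ZMod 2
  | none => 0
  | some (_, x) => x

/-- The cell of a given degree and label. -/
def ofDeg : ℕ → ZMod 2 → Cell
  | 0, _ => none
  | n + 1, x => some (n, x)

@[simp] lemma deg_ofDeg (n : ℕ) (x : ZMod 2) : (ofDeg n x).deg = n := by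
  cases n <;> rfl

lemma ofDeg_deg_label (a : Cell) : ofDeg a.deg a.label = a := by
  rcases a with _ | ⟨n, x⟩ <;> rfl

lemma shift_ofDeg (y : ZMod 2) (n : ℕ) (x : ZMod 2) :
    shift y (ofDeg n x) = ofDeg n (y + x) := by
  cases n <;> rfl

@[simp] lemma ofDeg_zero (x : ZMod 2) : ofDeg 0 x = none := rfl

@[simp] lemma label_ofDeg_succ (n : ℕ) (x : ZMod 2) : (ofDeg (n + 1) x).label = x := rfl

@[simp] lemma label_ofDeg_zero_right (n : ℕ) : (ofDeg n 0).label = 0 := by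
  cases n <;> rfl

@[simp] lemma cobd_none {M : Type*} [AddCommGroup M] (f : Cell → M) : cobd f none = 0 := rfl

@[simp] lemma cobd_ofDeg_one {M : Type*} [AddCommGroup M] (f : Cell → M) (x : ZMod 2) :
    cobd f (ofDeg 1 x) = f none := rfl

@[simp] lemma cobd_ofDeg_succ_succ {M : Type*} [AddCommGroup M] (f : Cell → M) (n : ℕ)
    (x : ZMod 2) :
    cobd f (ofDeg (n + 2) x) = f (ofDeg (n + 1) 0) + f (ofDeg (n + 1) 1) := rfl

end Cell

namespace JoinChain

open Cell

/-- The invariant cochains of degree `n` on the join. -/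
structure IsInvariant (n : ℕ) (c : JoinChain) : Prop where
  homog : c ∈ homog n
  rep : ∀ g, rep g c = c

/-- The value of a cochain at the orbit representative with given degrees and total label. -/
def val (c : JoinChain) (p q r : ℕ) (z : ZMod 2) : ZMod 2 := c (ofDeg p 0) (ofDeg q 0) (ofDeg r z)

variable {n : ℕ} {c : JoinChain}

/-- The group element with coordinates `(x, y)` moves the first two labels to `0` and adds `x + y`
to the third. -/
lemma IsInvariant.apply (hc : IsInvariant n c) (p q r : ℕ) (x y z : ZMod 2) :
    c (ofDeg p x) (ofDeg q y) (ofDeg r z) = val c p q r (x + y + z) := by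
  have h := congrFun (congrFun (congrFun (hc.rep (.ofAdd x, .ofAdd y)) (ofDeg p x)) (ofDeg q y))
    (ofDeg r z)
  rw [← h, rep_apply]
  simp only [kleinChar, shift_ofDeg, toAdd_ofAdd, CharTwo.add_self_eq_zero]
  rfl

/-- An empty cell carries no label, so a label assigned to it can absorb `z`: only one orbit exists
in these degrees. -/
lemma IsInvariant.val_eq (hc : IsInvariant n c) {p q r : ℕ} (h : p = 0 ∨ q = 0 ∨ r = 0)
    (z : ZMod 2) : val c p q r z = val c p q r 0 := by
  rcases h with rfl | rfl | rfl
  · have h := hc.apply 0 q r z 0 0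
    simpa [val] using h.symm
  · have h := hc.apply p 0 r 0 z 0
    simpa [val] using h.symm
  · rfl

/-- The value of a cochain on the sum of the cells with given degrees, up to symmetry. -/
def tr (c : JoinChain) (p q r : ℕ) : ZMod 2 :=
  if p = 0 ∨ q = 0 ∨ r = 0 then val c p q r 0 else val c p q r 0 + val c p q r 1

lemma IsInvariant.ext {c' : JoinChain} (hc : IsInvariant n c) (hc' : IsInvariant n c')
    (h : ∀ p q r z, p + q + r = n → val c p q r z = val c' p q r z) : c = c' := by
  funext a b d
  by_cases habd : a.deg + b.deg + d.deg = n
  · rw [← ofDeg_deg_label a, ← ofDeg_deg_label b, ← ofDeg_deg_label d, hc.apply, hc'.apply]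
    exact h _ _ _ _ habd
  · rw [hc.homog a b d habd, hc'.homog a b d habd]

lemma val_eq_zero (hc : IsInvariant n c) {p q r : ℕ} (h : p + q + r ≠ n) (z : ZMod 2) :
    val c p q r z = 0 := hc.homog _ _ _ (by simpa using h)

lemma add_val_one_add (c : JoinChain) (p q r : ℕ) (z : ZMod 2) :
    val c p q r z + val c p q r (1 + z) = val c p q r 0 + val c p q r 1 := by
  rcases zmod_two_cases z with rfl | rfl
  · rw [add_zero]
  · rw [show (1 + 1 : ZMod 2) = 0 from rfl, add_comm]

/-- For `p > 0` the two faces differ in one label. If `q` and `r` are positive they represent both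
orbits and give the trace; otherwise they lie in one orbit and cancel. For `p = 0` there is a single
face. -/
lemma IsInvariant.cobd_fst (hc : IsInvariant n c) (p q r : ℕ) (z : ZMod 2) :
    cobd (fun a => c a (ofDeg q 0) (ofDeg r z)) (ofDeg (p + 1) 0) =
      if q = 0 ∨ r = 0 then (if p = 0 then val c 0 q r 0 else 0) else tr c p q r := by
  cases p with
  | zero =>
    have h : val c 0 q r z = val c 0 q r 0 := hc.val_eq (.inl rfl) z
    simpa [tr, val] using h
  | succ p =>
    have h₀ := hc.apply (p + 1) q r 0 0 z
    have h₁ := hc.apply (p + 1) q r 1 0 z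
    simp only [add_zero, zero_add] at h₀ h₁
    simp only [cobd_ofDeg_succ_succ, h₀, h₁, add_val_one_add, tr, Nat.add_eq_zero_iff,
      one_ne_zero, and_false, false_or, if_false]
    split_ifs with h
    · rw [hc.val_eq (.inr h) 1, CharTwo.add_self_eq_zero]
    · rfl

lemma IsInvariant.cobd_snd (hc : IsInvariant n c) (p q r : ℕ) (z : ZMod 2) :
    cobd (fun b => c (ofDeg p 0) b (ofDeg r z)) (ofDeg (q + 1) 0) =
      if p = 0 ∨ r = 0 then (if q = 0 then val c p 0 r 0 else 0) else tr c p q r := by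
  cases q with
  | zero =>
    have h : val c p 0 r z = val c p 0 r 0 := hc.val_eq (.inr (.inl rfl)) z
    simpa [tr, val] using h
  | succ q =>
    have h₀ := hc.apply p (q + 1) r 0 0 z
    have h₁ := hc.apply p (q + 1) r 0 1 z
    simp only [add_zero, zero_add] at h₀ h₁
    simp only [cobd_ofDeg_succ_succ, h₀, h₁, add_val_one_add, tr, Nat.add_eq_zero_iff,
      one_ne_zero, and_false, false_or, if_false]
    split_ifs with h
    · rw [hc.val_eq (h.imp_right .inr) 1, CharTwo.add_self_eq_zero]
    · rfl

lemma IsInvariant.cobd_trd (hc : IsInvariant n c) (p q r : ℕ) (z : ZMod 2) :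
    cobd (fun d => c (ofDeg p 0) (ofDeg q 0) d) (ofDeg (r + 1) z) =
      if p = 0 ∨ q = 0 then (if r = 0 then val c p q 0 0 else 0) else tr c p q r := by
  cases r with
  | zero => simp [tr, val]
  | succ r =>
    change val c p q (r + 1) 0 + val c p q (r + 1) 1 = _
    simp only [tr, Nat.add_eq_zero_iff, one_ne_zero, and_false, or_false, if_false]
    split_ifs with h
    · rw [hc.val_eq (h.imp_right .inl) 1, CharTwo.add_self_eq_zero]
    · rfl

lemma val_cobdry (c : JoinChain) (p q r : ℕ) (z : ZMod 2) : val (cobdry c) p q r z =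
    cobd (fun a => c a (ofDeg q 0) (ofDeg r z)) (ofDeg p 0) +
      cobd (fun b => c (ofDeg p 0) b (ofDeg r z)) (ofDeg q 0) +
        cobd (fun d => c (ofDeg p 0) (ofDeg q 0) d) (ofDeg r z) := rfl

/-- Where all degrees are positive the coboundary sees only traces and does not depend on `z`. -/
lemma IsInvariant.val_cobdry_succ (hc : IsInvariant n c) (p q r : ℕ) (z : ZMod 2) :
    val (cobdry c) (p + 1) (q + 1) (r + 1) z =
      tr c p (q + 1) (r + 1) + tr c (p + 1) q (r + 1) + tr c (p + 1) (q + 1) r := by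
  rw [val_cobdry, hc.cobd_fst, hc.cobd_snd, hc.cobd_trd]
  simp

lemma IsInvariant.val_cobdry_zero_fst (hc : IsInvariant n c) (q r : ℕ) (z : ZMod 2) :
    val (cobdry c) 0 (q + 1) (r + 1) z =
      (if q = 0 then val c 0 0 (r + 1) 0 else 0) + (if r = 0 then val c 0 (q + 1) 0 0 else 0) := by
  rw [val_cobdry, hc.cobd_snd, hc.cobd_trd]
  simp

lemma IsInvariant.val_cobdry_zero_snd (hc : IsInvariant n c) (p r : ℕ) (z : ZMod 2) :
    val (cobdry c) (p + 1) 0 (r + 1) z =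
      (if p = 0 then val c 0 0 (r + 1) 0 else 0) + (if r = 0 then val c (p + 1) 0 0 0 else 0) := by
  rw [val_cobdry, hc.cobd_fst, hc.cobd_trd]
  simp

lemma IsInvariant.val_cobdry_zero_trd (hc : IsInvariant n c) (p q : ℕ) (z : ZMod 2) :
    val (cobdry c) (p + 1) (q + 1) 0 z =
      (if p = 0 then val c 0 (q + 1) 0 0 else 0) + (if q = 0 then val c (p + 1) 0 0 0 else 0) := by
  rw [val_cobdry, hc.cobd_fst, hc.cobd_snd]
  simp

/-- On cells with only one factor of positive degree, a coboundary of a cochain of positive degree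
vanishes. -/
lemma IsInvariant.val_cobdry_single (hc : IsInvariant (n + 1) c) {p q r : ℕ}
    (h : p = 0 ∧ q = 0 ∨ p = 0 ∧ r = 0 ∨ q = 0 ∧ r = 0) (z : ZMod 2) :
    val (cobdry c) p q r z = 0 := by
  have h0 : val c 0 0 0 0 = 0 := val_eq_zero hc (by omega) 0
  rw [val_cobdry]
  rcases h with ⟨rfl, rfl⟩ | ⟨rfl, rfl⟩ | ⟨rfl, rfl⟩
  · cases r with
    | zero => simp
    | succ r => rw [hc.cobd_trd]; simp [h0]
  · cases q with
    | zero => simp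
    | succ q => rw [hc.cobd_snd]; simp [h0]
  · cases p with
    | zero => simp
    | succ p => rw [hc.cobd_fst]; simp [h0]

/-- The cochain of degree `n` with given values at orbit representatives. -/
def mkCochain (n : ℕ) (W : ℕ → ℕ → ℕ → ZMod 2 → ZMod 2) : JoinChain := fun a b c =>
  if a.deg + b.deg + c.deg = n then W a.deg b.deg c.deg (a.label + b.label + c.label) else 0

lemma label_shift_of_deg_ne_zero (x : ZMod 2) (a : Cell) (ha : a.deg ≠ 0) :
    (shift x a).label = x + a.label := by
  rcases a with _ | ⟨n, y⟩
  · exact absurd rfl ha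
  · rfl

lemma isInvariant_mkCochain {W : ℕ → ℕ → ℕ → ZMod 2 → ZMod 2}
    (hW : ∀ p q r z, p = 0 ∨ q = 0 ∨ r = 0 → W p q r z = W p q r 0) :
    IsInvariant n (mkCochain n W) where
  homog _ _ _ h := if_neg h
  rep g := by
    funext a b c
    rw [rep_apply]
    simp only [mkCochain, deg_shift]
    congr 1
    by_cases h : a.deg = 0 ∨ b.deg = 0 ∨ c.deg = 0
    · rw [hW _ _ _ _ h]
      exact (hW _ _ _ _ h).symm
    · simp only [not_or] at h
      rw [label_shift_of_deg_ne_zero _ a h.1, label_shift_of_deg_ne_zero _ b h.2.1,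
        label_shift_of_deg_ne_zero _ c h.2.2]
      congr 1
      -- The three characters add up to zero, so the total label is preserved.
      simp only [kleinChar]
      linear_combination CharTwo.add_self_eq_zero
        (Multiplicative.toAdd g.1 + Multiplicative.toAdd g.2)

lemma val_mkCochain {W : ℕ → ℕ → ℕ → ZMod 2 → ZMod 2}
    (hW : ∀ p q r z, p = 0 ∨ q = 0 ∨ r = 0 → W p q r z = W p q r 0) {p q r : ℕ}
    (h : p + q + r = n) (z : ZMod 2) : val (mkCochain n W) p q r z = W p q r z := by
  simp only [val, mkCochain, deg_ofDeg, h, if_true, label_ofDeg_zero_right, zero_add]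
  cases r with
  | zero => exact (hW _ _ _ z (.inr (.inr rfl))).symm
  | succ r => rfl

/-- The cochain vanishing on cells with one positive degree and on cells with three positive
degrees and label `1`. -/
def traceCochain (n : ℕ) (A : ℕ → ℕ → ℕ → ZMod 2) : JoinChain :=
  mkCochain n fun p q r z =>
    if p = 0 ∧ q = 0 ∨ p = 0 ∧ r = 0 ∨ q = 0 ∧ r = 0 then 0
    else if p = 0 ∨ q = 0 ∨ r = 0 then A p q r else if z = 0 then A p q r else 0

lemma traceCochain_aux (A : ℕ → ℕ → ℕ → ZMod 2) (p q r : ℕ) (z : ZMod 2)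
    (h : p = 0 ∨ q = 0 ∨ r = 0) :
    (if p = 0 ∧ q = 0 ∨ p = 0 ∧ r = 0 ∨ q = 0 ∧ r = 0 then 0
    else if p = 0 ∨ q = 0 ∨ r = 0 then A p q r else if z = 0 then A p q r else 0) =
    (if p = 0 ∧ q = 0 ∨ p = 0 ∧ r = 0 ∨ q = 0 ∧ r = 0 then 0
    else if p = 0 ∨ q = 0 ∨ r = 0 then A p q r else if (0 : ZMod 2) = 0 then A p q r else 0) := by
  simp [h]

lemma isInvariant_traceCochain (A : ℕ → ℕ → ℕ → ZMod 2) : IsInvariant n (traceCochain n A) :=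
  isInvariant_mkCochain (traceCochain_aux A)

lemma val_traceCochain_single (A : ℕ → ℕ → ℕ → ZMod 2) {p q r : ℕ}
    (h : p = 0 ∧ q = 0 ∨ p = 0 ∧ r = 0 ∨ q = 0 ∧ r = 0) (z : ZMod 2) :
    val (traceCochain n A) p q r z = 0 := by
  by_cases hn : p + q + r = n
  · rw [traceCochain, val_mkCochain (traceCochain_aux A) hn, if_pos h]
  · exact val_eq_zero (isInvariant_traceCochain A) hn z

lemma tr_traceCochain (A : ℕ → ℕ → ℕ → ZMod 2) {p q r : ℕ} (hn : p + q + r = n)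
    (h : ¬ (p = 0 ∧ q = 0 ∨ p = 0 ∧ r = 0 ∨ q = 0 ∧ r = 0)) :
    tr (traceCochain n A) p q r = A p q r := by
  simp only [tr, traceCochain, val_mkCochain (traceCochain_aux A) hn, if_neg h]
  split_ifs <;> simp_all

/-- The solution of the recursion for traces of cocycles with given initial values. -/
def solve (f g : ℕ → ZMod 2) (u : ℕ → ℕ → ℕ → ZMod 2) : ℕ → ℕ → ℕ → ZMod 2
  -- On a fixed total degree the third index is determined by the other two.
  | 0, q, _ => f q
  | p + 1, 0, _ => g (p + 1)
  | p + 1, q + 1, r =>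
    -- The three-term relation is solved for the term with the smallest third degree. Each call
    -- trades a unit of `p` or `q` for one of `r`, preserving the total.
    u (p + 1) (q + 1) (r + 1) + solve f g u p (q + 1) (r + 1) + solve f g u (p + 1) q (r + 1)

lemma solve_spec (f g : ℕ → ZMod 2) (u : ℕ → ℕ → ℕ → ZMod 2) (p q r : ℕ) :
    solve f g u p (q + 1) (r + 1) + solve f g u (p + 1) q (r + 1) +
      solve f g u (p + 1) (q + 1) r = u (p + 1) (q + 1) (r + 1) := by
  rw [solve.eq_3]
  linear_combination CharTwo.add_self_eq_zero
    (solve f g u p (q + 1) (r + 1) + solve f g u (p + 1) q (r + 1))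

/-- Invariance comes for free once the coboundary is seen as precomposition with an equivariant map.
-/
lemma isInvariant_cobdry (hc : IsInvariant n c) : IsInvariant (n + 1) (cobdry c) := by
  obtain ⟨φ, rfl⟩ := exists_cochainOfHom_eq hc.homog hc.rep
  rw [← cochainOfHom_comp]
  exact ⟨cochainOfHom_mem_homog _, rep_cochainOfHom _⟩

/-- The coboundary of a trace cochain in degree `n + 1`. -/
lemma cobdry_traceCochain_solve (f g : ℕ → ZMod 2) (u : ℕ → ℕ → ℕ → ZMod 2)
    {c' : JoinChain} (hc' : IsInvariant (n + 2) c')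
    (h₁ : ∀ p q r z, p = 0 ∨ q = 0 ∨ r = 0 → p + q + r = n + 2 → val c' p q r z = 0)
    (h₂ : ∀ p q r z, p ≠ 0 → q ≠ 0 → r ≠ 0 → p + q + r = n + 2 → val c' p q r z = u p q r) :
    cobdry (traceCochain (n + 1) (solve f g u)) = c' := by
  have hT := isInvariant_traceCochain (n := n + 1) (solve f g u)
  refine (isInvariant_cobdry hT).ext hc' fun p q r z h => ?_
  by_cases hs : p = 0 ∧ q = 0 ∨ p = 0 ∧ r = 0 ∨ q = 0 ∧ r = 0
  · rw [hT.val_cobdry_single hs, h₁ _ _ _ _ (by omega) h]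
  rcases p with _ | p
  · rw [h₁ _ _ _ _ (by omega) h]
    obtain ⟨q, rfl⟩ : ∃ m, q = m + 1 := ⟨q - 1, by omega⟩
    obtain ⟨r, rfl⟩ : ∃ m, r = m + 1 := ⟨r - 1, by omega⟩
    rw [hT.val_cobdry_zero_fst, val_traceCochain_single _ (by omega),
      val_traceCochain_single _ (by omega)]
    simp
  rcases q with _ | q
  · rw [h₁ _ _ _ _ (by omega) h]
    obtain ⟨r, rfl⟩ : ∃ m, r = m + 1 := ⟨r - 1, by omega⟩
    rw [hT.val_cobdry_zero_snd, val_traceCochain_single _ (by omega),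
      val_traceCochain_single _ (by omega)]
    simp
  rcases r with _ | r
  · rw [h₁ _ _ _ _ (by omega) h, hT.val_cobdry_zero_trd, val_traceCochain_single _ (by omega),
      val_traceCochain_single _ (by omega)]
    simp
  rw [h₂ _ _ _ _ (by omega) (by omega) (by omega) h, hT.val_cobdry_succ,
    tr_traceCochain _ (by omega) (by omega), tr_traceCochain _ (by omega) (by omega),
    tr_traceCochain _ (by omega) (by omega), solve_spec]

end JoinChain

end RelCohomology

/-! ### Cocycles, initial values and the dimensions of the cohomology -/

namespace RelCohomology

namespace JoinChain

variable {n : ℕ} {c : JoinChain}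

/-- The values of a cochain of degree `n + 2` that determine the class of a cocycle. -/
def initialValues (n : ℕ) :
    JoinChain →ₗ[ZMod 2] (Fin (n + 1) → ZMod 2) × (Fin (n + 1) → ZMod 2) where
  toFun c := (fun j => val c 0 (j + 1) (n - j + 1) 0, fun j => val c (j + 1) 0 (n - j + 1) 0)
  map_add' _ _ := rfl
  map_smul' _ _ := rfl

/-- The initial values of the coboundary of a cochain, in terms of the values of the cochain on
cells with only one factor of positive degree. -/
def singleValues (n : ℕ) : ZMod 2 × ZMod 2 × ZMod 2 →ₗ[ZMod 2]
    (Fin (n + 1) → ZMod 2) × (Fin (n + 1) → ZMod 2) where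
  toFun x :=
    (fun j => (if (j : ℕ) = 0 then x.2.2 else 0) + (if n - j = 0 then x.2.1 else 0),
      fun j => (if (j : ℕ) = 0 then x.2.2 else 0) + (if n - j = 0 then x.1 else 0))
  map_add' x y := by
    ext j <;> simp only [Prod.fst_add, Prod.snd_add, Pi.add_apply] <;> split_ifs <;> ring
  map_smul' r x := by
    ext j <;> simp only [Prod.smul_fst, Prod.smul_snd, Pi.smul_apply, smul_eq_mul,
      RingHom.id_apply] <;> split_ifs <;> ring

lemma initialValues_cobdry (hc : IsInvariant (n + 1) c) : initialValues n (cobdry c) =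
    singleValues n (val c (n + 1) 0 0 0, val c 0 (n + 1) 0 0, val c 0 0 (n + 1) 0) := by
  refine Prod.ext ?_ ?_
  · funext j
    change val (cobdry c) 0 (j + 1) (n - j + 1) 0 = (if (j : ℕ) = 0 then _ else 0) +
      (if n - j = 0 then _ else 0)
    rw [hc.val_cobdry_zero_fst]
    congr 1
    · split_ifs with h
      · rw [h]; rfl
      · rfl
    · split_ifs with h
      · rw [show (j : ℕ) = n by omega]
      · rfl
  · funext j
    change val (cobdry c) (j + 1) 0 (n - j + 1) 0 = (if (j : ℕ) = 0 then _ else 0) +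
      (if n - j = 0 then _ else 0)
    rw [hc.val_cobdry_zero_snd]
    congr 1
    · split_ifs with h
      · rw [h]; rfl
      · rfl
    · split_ifs with h
      · rw [show (j : ℕ) = n by omega]
      · rfl

lemma exists_invariant_single_values (x : ZMod 2 × ZMod 2 × ZMod 2) :
    ∃ c, IsInvariant (n + 1) c ∧
      (val c (n + 1) 0 0 0, val c 0 (n + 1) 0 0, val c 0 0 (n + 1) 0) = x := by
  let W (p q r : ℕ) (_ : ZMod 2) : ZMod 2 :=
    if q = 0 ∧ r = 0 then x.1 else if p = 0 ∧ r = 0 then x.2.1 else if p = 0 ∧ q = 0 then x.2.2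
    else 0
  have hW : ∀ p q r z, p = 0 ∨ q = 0 ∨ r = 0 → W p q r z = W p q r 0 := fun _ _ _ _ _ => rfl
  refine ⟨mkCochain (n + 1) W, isInvariant_mkCochain hW, ?_⟩
  rw [val_mkCochain hW (by omega), val_mkCochain hW (by omega), val_mkCochain hW (by omega)]
  simp [W]

/-- The homogeneous recursion can be started from any values on the planes `p = 0` and `q = 0`; the
plane `r = 0` is then an output. -/
lemma exists_cocycle_initialValues (v : (Fin (n + 1) → ZMod 2) × (Fin (n + 1) → ZMod 2)) :
    ∃ c, IsInvariant (n + 2) c ∧ cobdry c = 0 ∧ initialValues n c = v := by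
  -- The value at first degree `0` and second degree `q` has index `q - 1`, since positive degrees
  -- are numbered from `0`.
  let f (q : ℕ) : ZMod 2 := if h : q - 1 < n + 1 then v.1 ⟨q - 1, h⟩ else 0
  let g (p : ℕ) : ZMod 2 := if h : p - 1 < n + 1 then v.2 ⟨p - 1, h⟩ else 0
  have h0 : IsInvariant (n + 1 + 2) 0 := ⟨Submodule.zero_mem _, fun g => map_zero (rep g)⟩
  refine ⟨traceCochain (n + 2) (solve f g 0), isInvariant_traceCochain _,
    cobdry_traceCochain_solve f g 0 h0 (fun _ _ _ _ _ _ => rfl) (fun _ _ _ _ _ _ _ _ => rfl), ?_⟩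
  refine Prod.ext ?_ ?_
  · funext j
    have h := tr_traceCochain (n := n + 2) (solve f g 0) (p := 0) (q := j + 1) (r := n - j + 1)
      (by omega) (by omega)
    rw [tr, if_pos (by omega)] at h
    refine h.trans ?_
    simp only [solve, f, Nat.add_sub_cancel, dif_pos j.2]
  · funext j
    have h := tr_traceCochain (n := n + 2) (solve f g 0) (p := j + 1) (q := 0) (r := n - j + 1)
      (by omega) (by omega)
    rw [tr, if_pos (by omega)] at h
    refine h.trans ?_
    simp only [solve, g, Nat.add_sub_cancel, dif_pos j.2]

@[simp] lemma val_zero (p q r : ℕ) (z : ZMod 2) : val 0 p q r z = 0 := rfl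

/-- A cocycle with vanishing initial values has vanishing traces. -/
lemma tr_eq_zero (hc : IsInvariant (n + 2) c) (hd : cobdry c = 0) (hi : initialValues n c = 0)
    (p q r : ℕ) (h : p + q + r = n + 2)
    (h' : ¬ (p = 0 ∧ q = 0 ∨ p = 0 ∧ r = 0 ∨ q = 0 ∧ r = 0)) : tr c p q r = 0 := by
  induction p generalizing q r with
  | zero =>
    rw [tr, if_pos (.inl rfl)]
    have := congrFun (congrArg Prod.fst hi) ⟨q - 1, by omega⟩
    change val c 0 (q - 1 + 1) (n - (q - 1) + 1) 0 = 0 at this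
    rwa [show q - 1 + 1 = q by omega, show n - (q - 1) + 1 = r by omega] at this
  | succ p ihp =>
    induction q generalizing r with
    | zero =>
      rw [tr, if_pos (.inr (.inl rfl))]
      have := congrFun (congrArg Prod.snd hi) ⟨p, by omega⟩
      change val c (p + 1) 0 (n - p + 1) 0 = 0 at this
      rwa [show n - p + 1 = r by omega] at this
    | succ q ihq =>
      have key := hc.val_cobdry_succ p q r 0
      rw [hd, ihp (q + 1) (r + 1) (by omega) (by omega), ihq (r + 1) (by omega) (by omega),
        zero_add, zero_add] at key
      exact key.symm

/-- The cocycle condition is tested on a cell with one further factor of degree `1`. As the original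
degree is at least `2`, its other faces cancel. In degree `1` this fails, which is where the class
in cohomological degree `0` comes from. -/
lemma val_single_eq_zero (hc : IsInvariant (n + 2) c) (hd : cobdry c = 0) {p q r : ℕ}
    (h : p + q + r = n + 2) (h' : p = 0 ∧ q = 0 ∨ p = 0 ∧ r = 0 ∨ q = 0 ∧ r = 0) :
    val c p q r 0 = 0 := by
  rcases h' with ⟨rfl, rfl⟩ | ⟨rfl, rfl⟩ | ⟨rfl, rfl⟩
  · obtain rfl : r = n + 2 := by omega
    have key := hc.val_cobdry_zero_fst 0 (n + 1) 0
    rw [hd] at key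
    simpa using key.symm
  · obtain rfl : q = n + 2 := by omega
    have key := hc.val_cobdry_zero_trd 0 (n + 1) 0
    rw [hd] at key
    simpa using key.symm
  · obtain rfl : p = n + 2 := by omega
    have key := hc.val_cobdry_zero_trd (n + 1) 0 0
    rw [hd] at key
    simpa using key.symm

/-- With vanishing traces, the cocycle is zero where some degree is zero and independent of `z`
elsewhere. It can therefore serve as the source term of the recursion, started from zero. -/
lemma exists_cobdry_eq (hc : IsInvariant (n + 2) c) (hd : cobdry c = 0)
    (hi : initialValues n c = 0) : ∃ c', IsInvariant (n + 1) c' ∧ cobdry c' = c := by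
  refine ⟨traceCochain (n + 1) (solve 0 0 fun p q r => val c p q r 0),
    isInvariant_traceCochain _, cobdry_traceCochain_solve _ _ _ hc ?_ ?_⟩
  · intro p q r z h hn
    rw [hc.val_eq h]
    by_cases hs : p = 0 ∧ q = 0 ∨ p = 0 ∧ r = 0 ∨ q = 0 ∧ r = 0
    · exact val_single_eq_zero hc hd hn hs
    · have := tr_eq_zero hc hd hi p q r hn hs
      rwa [tr, if_pos h] at this
  · intro p q r z hp hq hr hn
    have := tr_eq_zero hc hd hi p q r hn (by omega)
    rw [tr, if_neg (by omega)] at this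
    rcases zmod_two_cases z with rfl | rfl
    · rfl
    · exact (CharTwo.add_eq_zero.1 this).symm

/-- For `n = 0` the first and last index coincide, and three values cover the two initial ones. -/
lemma singleValues_zero_surjective : Function.Surjective (singleValues 0) := by
  intro v
  refine ⟨(v.2 0, v.1 0, 0), ?_⟩
  refine Prod.ext ?_ ?_ <;>
  · funext j
    obtain rfl : j = 0 := Fin.ext (by omega)
    simp [singleValues]

/-- The first and last index now differ, so each of the three values can be read off separately. -/
lemma singleValues_injective : Function.Injective (singleValues (n + 1)) := by
  rw [← LinearMap.ker_eq_bot, LinearMap.ker_eq_bot']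
  intro x hx
  have h₁ := congrFun (congrArg Prod.fst hx) 0
  have h₂ := congrFun (congrArg Prod.fst hx) (Fin.last _)
  have h₃ := congrFun (congrArg Prod.snd hx) (Fin.last _)
  simp [singleValues] at h₁ h₂ h₃
  exact Prod.ext h₃ (Prod.ext h₂ h₁)

end JoinChain

/-- Computing the homology of `A ⟶ B ⟶ C` by a map from `B`. -/
lemma nonempty_quotient_equiv {K A B C X V : Type*} [Field K] [AddCommGroup A] [Module K A]
    [AddCommGroup B] [Module K B] [AddCommGroup C] [Module K C] [AddCommGroup X] [Module K X]
    [AddCommGroup V] [Module K V] (f : A →ₗ[K] B) (g : B →ₗ[K] C) (φ : B →ₗ[K] V) (l : X →ₗ[K] V)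
    (hgf : ∀ a, g (f a) = 0)
    (h₁ : ∀ v, ∃ b, g b = 0 ∧ φ b = v) (h₂ : ∀ a, ∃ x, φ (f a) = l x)
    (h₃ : ∀ x, ∃ a, φ (f a) = l x) (h₄ : ∀ b, g b = 0 → φ b = 0 → ∃ a, f a = b) :
    Nonempty ((LinearMap.ker g ⧸ (LinearMap.range f).submoduleOf (LinearMap.ker g)) ≃ₗ[K]
      V ⧸ LinearMap.range l) := by
  let ψ : LinearMap.ker g →ₗ[K] V ⧸ LinearMap.range l :=
    (LinearMap.range l).mkQ ∘ₗ φ ∘ₗ (LinearMap.ker g).subtype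
  have hψ : Function.Surjective ψ := by
    intro v
    obtain ⟨v, rfl⟩ := Submodule.mkQ_surjective _ v
    obtain ⟨b, hb, rfl⟩ := h₁ v
    exact ⟨⟨b, hb⟩, rfl⟩
  have hk : (LinearMap.range f).submoduleOf (LinearMap.ker g) = LinearMap.ker ψ := by
    ext ⟨b, hb⟩
    have hψb : ψ ⟨b, hb⟩ = 0 ↔ φ b ∈ LinearMap.range l := Submodule.Quotient.mk_eq_zero _
    rw [LinearMap.mem_ker, hψb]
    constructor
    · rintro ⟨a, ha⟩
      obtain ⟨x, hx⟩ := h₂ a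
      exact ⟨x, hx.symm.trans (congrArg φ ha)⟩
    · rintro ⟨x, hx⟩
      obtain ⟨a, ha⟩ := h₃ x
      -- Subtracting a coboundary with the same invariant reduces to the case of invariant zero.
      obtain ⟨a', ha'⟩ := h₄ (b - f a) (by rw [map_sub, hgf, hb, sub_zero])
        (by rw [map_sub, ha, hx, sub_self])
      exact ⟨a' + a, by rw [map_add, ha']; simp⟩
  exact ⟨Submodule.quotEquivOfEq _ _ hk ≪≫ₗ ψ.quotKerEquivOfSurjective hψ⟩

/-- The trivial module `𝔽₂` of the Klein four-group. -/
noncomputable abbrev trivialF2 : Rep (ZMod 2) KleinFour := Rep.trivial (ZMod 2) KleinFour (ZMod 2)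

open JoinChain

lemma coboundaryMap_joinComplex (n : ℕ) (φ : joinRep (n + 1) ⟶ trivialF2) :
    coboundaryMap joinComplex trivialF2 n (n + 1) φ = joinD (n + 1) ≫ φ := by
  change joinComplex.d (n + 1) n ≫ φ = _
  rw [joinComplex_d]
  rfl

lemma cochainOfHom_coboundaryMap (n : ℕ) (φ : joinRep (n + 1) ⟶ trivialF2) :
    cochainOfHom (n + 2) (coboundaryMap joinComplex trivialF2 n (n + 1) φ) =
      cobdry (cochainOfHom (n + 1) φ) := by
  rw [coboundaryMap_joinComplex]
  exact cochainOfHom_comp φ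

lemma isInvariant_cochainOfHom {n : ℕ} (φ : joinRep n ⟶ trivialF2) : IsInvariant n (cochainOfHom n φ) :=
  ⟨cochainOfHom_mem_homog φ, rep_cochainOfHom φ⟩

lemma nonempty_join_homology_succ_equiv (n : ℕ) :
    Nonempty ((joinComplex.linearYonedaObj (ZMod 2) trivialF2).homology (n + 1) ≃ₗ[ZMod 2]
      ((Fin (n + 1) → ZMod 2) × (Fin (n + 1) → ZMod 2)) ⧸ LinearMap.range (singleValues n)) := by
  obtain ⟨e₁⟩ := nonempty_homology_succ_equiv joinComplex trivialF2 n
  have hinj {m : ℕ} {φ ψ : joinRep m ⟶ trivialF2} (h : cochainOfHom m φ = cochainOfHom m ψ) : φ = ψ :=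
    cochainOfHom_injective h
  obtain ⟨e₂⟩ := nonempty_quotient_equiv
    (coboundaryMap joinComplex trivialF2 n (n + 1)) (coboundaryMap joinComplex trivialF2 (n + 1) (n + 2))
    (initialValues n ∘ₗ cochainOfHom (n + 2)) (singleValues n)
    (fun φ => by
      change joinComplex.d (n + 2) (n + 1) ≫ joinComplex.d (n + 1) n ≫ φ = 0
      rw [HomologicalComplex.d_comp_d_assoc, zero_comp])
    (fun v => by
      obtain ⟨c, hc, hd, hv⟩ := exists_cocycle_initialValues v
      obtain ⟨φ, rfl⟩ := exists_cochainOfHom_eq hc.homog hc.rep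
      refine ⟨φ, hinj ?_, hv⟩
      refine (cochainOfHom_coboundaryMap (n + 1) φ).trans (hd.trans ?_)
      exact (map_zero _).symm)
    (fun φ => ⟨_, (congrArg (initialValues n) (cochainOfHom_coboundaryMap n φ)).trans
      (initialValues_cobdry (isInvariant_cochainOfHom φ))⟩)
    (fun x => by
      obtain ⟨c, hc, rfl⟩ := exists_invariant_single_values (n := n) x
      obtain ⟨φ, rfl⟩ := exists_cochainOfHom_eq hc.homog hc.rep
      exact ⟨φ, (congrArg (initialValues n) (cochainOfHom_coboundaryMap n φ)).trans
        (initialValues_cobdry hc)⟩)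
    (fun φ hφ hv => by
      have hd : cobdry (cochainOfHom (n + 2) φ) = 0 := by
        rw [← cochainOfHom_coboundaryMap (n + 1) φ, hφ]
        exact map_zero (cochainOfHom (n + 3))
      obtain ⟨c, hc, hcφ⟩ := exists_cobdry_eq (isInvariant_cochainOfHom φ) hd hv
      obtain ⟨ψ, rfl⟩ := exists_cochainOfHom_eq hc.homog hc.rep
      exact ⟨ψ, hinj ((cochainOfHom_coboundaryMap n ψ).trans hcφ)⟩)
  exact ⟨e₁ ≪≫ₗ e₂⟩

/-- The join is connected: its three vertex orbits are linked by edges between different factors, so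
cocycles are constant. -/
lemma nonempty_join_homology_zero_equiv :
    Nonempty ((joinComplex.linearYonedaObj (ZMod 2) trivialF2).homology 0 ≃ₗ[ZMod 2] ZMod 2) := by
  obtain ⟨e⟩ := nonempty_homology_zero_equiv joinComplex trivialF2
  let v : JoinChain →ₗ[ZMod 2] ZMod 2 :=
    { toFun := fun c => val c 1 0 0 0
      map_add' := fun _ _ => rfl
      map_smul' := fun _ _ => rfl }
  let f : LinearMap.ker (coboundaryMap joinComplex trivialF2 0 1) →ₗ[ZMod 2] ZMod 2 :=
    v ∘ₗ cochainOfHom 1 ∘ₗ (LinearMap.ker (coboundaryMap joinComplex trivialF2 0 1)).subtype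
  refine ⟨e ≪≫ₗ LinearEquiv.ofBijective f ⟨?_, ?_⟩⟩
  · rw [← LinearMap.ker_eq_bot, LinearMap.ker_eq_bot']
    rintro ⟨φ, hφ⟩ (h : val (cochainOfHom 1 φ) 1 0 0 0 = 0)
    have hc := isInvariant_cochainOfHom (n := 1) φ
    have hd : cobdry (cochainOfHom 1 φ) = 0 := by
      rw [← cochainOfHom_coboundaryMap 0 φ, LinearMap.mem_ker.1 hφ]
      exact map_zero (cochainOfHom 2)
    have h₁ := hc.val_cobdry_zero_trd 0 0 0
    have h₂ := hc.val_cobdry_zero_snd 0 0 0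
    simp only [hd, if_true, zero_add, h, add_zero] at h₁ h₂
    have h0 : IsInvariant 1 0 := ⟨Submodule.zero_mem _, fun g => map_zero (rep g)⟩
    have hz : cochainOfHom 1 φ = 0 := hc.ext h0 fun p q r z hpqr => by
      rw [hc.val_eq (by omega)]
      obtain ⟨rfl, rfl, rfl⟩ | ⟨rfl, rfl, rfl⟩ | ⟨rfl, rfl, rfl⟩ :
        (p = 1 ∧ q = 0 ∧ r = 0) ∨ (p = 0 ∧ q = 1 ∧ r = 0) ∨ (p = 0 ∧ q = 0 ∧ r = 1) := by omega
      · exact h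
      · exact h₁.symm
      · exact h₂.symm
    exact Subtype.ext (cochainOfHom_injective (n := 1) (hz.trans (map_zero _).symm))
  · intro x
    have hW : ∀ p q r z, p = 0 ∨ q = 0 ∨ r = 0 →
        (fun (_ _ _ : ℕ) (_ : ZMod 2) => x) p q r z = x := fun _ _ _ _ _ => rfl
    have hc := isInvariant_mkCochain (n := 1) hW
    have hval {p q r : ℕ} (z : ZMod 2) (h : p + q + r = 1) := val_mkCochain (n := 1) hW h z
    obtain ⟨φ, hφ⟩ := exists_cochainOfHom_eq hc.homog hc.rep
    have h0 : IsInvariant 2 0 := ⟨Submodule.zero_mem _, fun g => map_zero (rep g)⟩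
    have hd : cobdry (cochainOfHom 1 φ) = 0 := by
      rw [hφ]
      refine (isInvariant_cobdry hc).ext h0 fun p q r z hpqr => ?_
      by_cases hs : p = 0 ∧ q = 0 ∨ p = 0 ∧ r = 0 ∨ q = 0 ∧ r = 0
      · exact hc.val_cobdry_single hs z
      · obtain ⟨rfl, rfl, rfl⟩ | ⟨rfl, rfl, rfl⟩ | ⟨rfl, rfl, rfl⟩ :
          (p = 0 ∧ q = 1 ∧ r = 1) ∨ (p = 1 ∧ q = 0 ∧ r = 1) ∨ (p = 1 ∧ q = 1 ∧ r = 0) := by omega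
        · refine (hc.val_cobdry_zero_fst 0 0 z).trans ?_
          rw [hval _ (by omega), hval _ (by omega)]
          exact CharTwo.add_self_eq_zero x
        · refine (hc.val_cobdry_zero_snd 0 0 z).trans ?_
          rw [hval _ (by omega), hval _ (by omega)]
          exact CharTwo.add_self_eq_zero x
        · refine (hc.val_cobdry_zero_trd 0 0 z).trans ?_
          rw [hval _ (by omega), hval _ (by omega)]
          exact CharTwo.add_self_eq_zero x
    refine ⟨⟨φ, cochainOfHom_injective (n := 2) ?_⟩, ?_⟩
    · exact (cochainOfHom_coboundaryMap 0 φ).trans (hd.trans (map_zero _).symm)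
    · change val (cochainOfHom 1 φ) 1 0 0 0 = x
      rw [hφ, hval _ (by omega)]

lemma nonempty_relCohomology_equiv (P : RelProjResolution (cyclicFamily KleinFour) trivialF2) (n : ℕ) :
    Nonempty (relCohomology P trivialF2 n ≃ₗ[ZMod 2]
      (joinComplex.linearYonedaObj (ZMod 2) trivialF2).homology n) := by
  obtain ⟨e⟩ := P.nonempty_homotopyEquiv joinResolution
  exact (nonempty_homology_iso e trivialF2 n).map Iso.toLinearEquiv

lemma finite_relCohomology (P : RelProjResolution (cyclicFamily KleinFour) trivialF2) (n : ℕ) :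
    Module.Finite (ZMod 2) (relCohomology P trivialF2 n) := by
  obtain ⟨e⟩ := nonempty_relCohomology_equiv P n
  cases n with
  | zero =>
    obtain ⟨e'⟩ := nonempty_join_homology_zero_equiv
    exact Module.Finite.equiv (e ≪≫ₗ e').symm
  | succ n =>
    obtain ⟨e'⟩ := nonempty_join_homology_succ_equiv n
    exact Module.Finite.equiv (e ≪≫ₗ e').symm

lemma finrank_relCohomology_zero (P : RelProjResolution (cyclicFamily KleinFour) trivialF2) :
    Module.finrank (ZMod 2) (relCohomology P trivialF2 0) = 1 := by
  obtain ⟨e⟩ := nonempty_relCohomology_equiv P 0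
  obtain ⟨e'⟩ := nonempty_join_homology_zero_equiv
  rw [(e ≪≫ₗ e').finrank_eq, Module.finrank_self]

lemma finrank_relCohomology_one (P : RelProjResolution (cyclicFamily KleinFour) trivialF2) :
    Module.finrank (ZMod 2) (relCohomology P trivialF2 1) = 0 := by
  obtain ⟨e⟩ := nonempty_relCohomology_equiv P 1
  obtain ⟨e'⟩ := nonempty_join_homology_succ_equiv 0
  have : Subsingleton (((Fin 1 → ZMod 2) × (Fin 1 → ZMod 2)) ⧸ LinearMap.range (singleValues 0)) :=
    Submodule.Quotient.subsingleton_iff.2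
      (LinearMap.range_eq_top.2 singleValues_zero_surjective)
  rw [(e ≪≫ₗ e').finrank_eq]
  exact Module.finrank_zero_of_subsingleton

lemma finrank_relCohomology_add_two (P : RelProjResolution (cyclicFamily KleinFour) trivialF2) (n : ℕ) :
    Module.finrank (ZMod 2) (relCohomology P trivialF2 (n + 2)) = 2 * n + 1 := by
  obtain ⟨e⟩ := nonempty_relCohomology_equiv P (n + 2)
  obtain ⟨e'⟩ := nonempty_join_homology_succ_equiv (n + 1)
  rw [(e ≪≫ₗ e').finrank_eq]
  have h := Submodule.finrank_quotient_add_finrank (LinearMap.range (singleValues (n + 1)))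
  rw [LinearMap.finrank_range_of_inj singleValues_injective] at h
  simp only [Module.finrank_prod, Module.finrank_self, Module.finrank_fin_fun] at h
  omega

lemma not_isPeriodic_relCohomology (P : RelProjResolution (cyclicFamily KleinFour) trivialF2) :
    ¬ IsPeriodic (relCohomology P trivialF2) := by
  rintro ⟨d, hd, N, h⟩
  obtain ⟨e⟩ := h (N + 2) (by omega)
  have h' := e.toLinearEquiv.finrank_eq
  rw [finrank_relCohomology_add_two, show N + 2 + d = N + d + 2 by omega,
    finrank_relCohomology_add_two] at h'
  omega

end RelCohomology

/-! ### Reduction mod 2 and the absence of a periodic permutation resolution -/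

namespace RelCohomology

open TensorProduct

section BaseChange

variable {k : Type u} (k' : Type u) {G : Type u} [CommRing k] [CommRing k'] [Algebra k k'] [Group G]

/-- Extension of scalars of a representation. -/
noncomputable def baseChangeRep {V : Type u} [AddCommGroup V] [Module k V]
    (ρ : Representation k G V) : Representation k' G (k' ⊗[k] V) where
  toFun g := (ρ g).baseChange k'
  map_one' := by rw [map_one]; exact LinearMap.baseChange_id
  map_mul' g h := by rw [map_mul]; exact LinearMap.baseChange_comp _ _

/-- Extension of scalars as a functor. -/
noncomputable def baseChangeFunctor (k : Type u) (k' : Type u) (G : Type u) [CommRing k]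
    [CommRing k'] [Algebra k k'] [Group G] : Rep.{u} k G ⥤ Rep.{u} k' G where
  obj A := Rep.of (baseChangeRep k' A.ρ)
  map f := Rep.ofHom ⟨f.hom.toLinearMap.baseChange k', fun g => by
    change (f.hom.toLinearMap.baseChange k') ∘ₗ LinearMap.baseChange k' _ =
      LinearMap.baseChange k' _ ∘ₗ (f.hom.toLinearMap.baseChange k')
    rw [← LinearMap.baseChange_comp, ← LinearMap.baseChange_comp, f.hom.isIntertwining']⟩
  map_id A := by
    ext : 2
    exact LinearMap.baseChange_id
  map_comp f g := by
    ext : 2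
    exact LinearMap.baseChange_comp _ _

instance : (baseChangeFunctor k k' G).Additive where
  map_add {A B f g} := by
    ext : 2
    exact LinearMap.baseChange_add _ _

/-- Extension of scalars of the trivial module. -/
noncomputable def baseChangeTrivialIso :
    (baseChangeFunctor k k' G).obj (Rep.trivial k G k) ≅ Rep.trivial k' G k' :=
  Rep.mkIso (.mk (AlgebraTensorModule.rid k k' k') fun g => by
    refine AlgebraTensorModule.ext fun x y => ?_
    rfl)

open scoped Classical in
/-- Extension of scalars of a permutation module. -/
noncomputable def baseChangeOfMulActionIso (X : Type u) [MulAction G X] :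
    (baseChangeFunctor k k' G).obj (Rep.ofMulAction k G X) ≅ Rep.ofMulAction k' G X :=
  Rep.mkIso (.mk (AlgebraTensorModule.congr (.refl k' k') (MonoidAlgebra.coeffLinearEquiv k) ≪≫ₗ
    finsuppScalarRight k k' k' X ≪≫ₗ (MonoidAlgebra.coeffLinearEquiv k').symm) fun g => by
    refine AlgebraTensorModule.ext fun a v => ?_
    ext x
    refine Eq.trans ?_ (Representation.coeff_ofMulAction g _ x).symm
    change finsuppScalarRight k k' k' X (a ⊗ₜ (Representation.ofMulAction k G X g v).coeff) x =
      finsuppScalarRight k k' k' X (a ⊗ₜ v.coeff) (g⁻¹ • x)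
    rw [finsuppScalarRight_apply_tmul_apply, finsuppScalarRight_apply_tmul_apply,
      Representation.coeff_ofMulAction])

variable {F : SubgroupFamily G}

/-- Splittings survive any additive functor. Exactness after tensoring is not automatic; it follows
from the splitting over the trivial subgroup. -/
lemma IsFSplit.baseChange {S : ShortComplex (Rep.{u} k G)} (hS : IsFSplit F S)
    (hF : ⊥ ∈ F.carrier) : IsFSplit F (S.map (baseChangeFunctor k k' G)) := by
  have key (H : Subgroup G) (hH : H ∈ F.carrier) : Nonempty
      ((S.map (baseChangeFunctor k k' G)).map (Rep.resFunctor H.subtype)).Splitting := by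
    obtain ⟨s⟩ := hS.2 H hH
    exact ⟨s.map (baseChangeFunctor k k' H)⟩
  refine ⟨?_, key⟩
  obtain ⟨s⟩ := key ⊥ hF
  exact (Rep.shortExact_res _).1 s.shortExact

end BaseChange

variable {k G : Type u} [CommRing k] [Group G] {F : SubgroupFamily G}

/-- A relative projective resolution of a module is one of any isomorphic module. -/
noncomputable def RelProjResolution.ofIso {M N : Rep.{u} k G} (Q : RelProjResolution F M)
    (e : M ≅ N) : RelProjResolution F N where
  complex := Q.complex
  aug := Q.aug ≫ e.hom
  d_comp_aug := by rw [← Category.assoc, Q.d_comp_aug, zero_comp]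
  epi_aug := have := Q.epi_aug; epi_comp _ _
  exact_zero := by
    let φ : ShortComplex.mk (Q.complex.d 1 0) Q.aug Q.d_comp_aug ≅
        ShortComplex.mk (Q.complex.d 1 0) (Q.aug ≫ e.hom)
          (by rw [← Category.assoc, Q.d_comp_aug, zero_comp]) :=
      ShortComplex.isoMk (Iso.refl _) (Iso.refl _) e (by simp) (by simp)
    exact (ShortComplex.exact_iff_of_iso φ).1 Q.exact_zero
  exact_succ := Q.exact_succ
  projective := Q.projective
  split_aug :=
    have := Q.epi_aug
    isFSplit_kernelImage_of_factorization rfl fun _ hH => Q.split_aug.exists_section hH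
  split_d := Q.split_d

/-- In an exact sequence, the image of a map is the kernel of the next one. -/
noncomputable def imageIsoKernel {S : ShortComplex (Rep.{u} k G)} (hS : S.Exact) :
    image S.f ≅ kernel S.g :=
  have : Mono (ShortComplex.mk (image.ι S.f) S.g (image_ι_comp_eq_zero S)).f :=
    inferInstanceAs (Mono (image.ι S.f))
  IsLimit.conePointUniqueUpToIso (exact_image_ι hS).fIsKernel (limit.isLimit (parallelPair S.g 0))

/-- Splicing a resolution with an exact sequence of relative projective modules. -/
lemma exists_spliced_resolution {k' : Type u} [CommRing k'] [Algebra k k']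
    (hF : ⊥ ∈ F.carrier) (C : ChainComplex (Rep.{u} k G) ℕ) (hC : C.Acyclic)
    (hsplit : ∀ m, IsFSplit F (kernelImage (C.d (m + 1) m))) (M : Rep.{u} k' G) (l j m : ℕ)
    (hproj : ∀ i < j, IsFProjective F ((baseChangeFunctor k k' G).obj (C.X (m + i + 1))))
    (Q : RelProjResolution F
      ((baseChangeFunctor k k' G).obj (image (C.d (m + j + 1) (m + j))))) :
    ∃ R : RelProjResolution F ((baseChangeFunctor k k' G).obj (image (C.d (m + 1) m))),
      Nonempty ((R.complex.linearYonedaObj k' M).homology (l + 1 + j) ≅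
        (Q.complex.linearYonedaObj k' M).homology (l + 1)) := by
  induction j generalizing m with
  | zero => exact ⟨Q, ⟨Iso.refl _⟩⟩
  | succ j ih =>
    have hm : m + (j + 1) = m + 1 + j := by omega
    revert Q
    rw [hm]
    intro Q
    obtain ⟨R, ⟨e⟩⟩ := ih (m + 1) (fun i hi => by
      have := hproj (i + 1) (by omega)
      rwa [show m + (i + 1) + 1 = m + 1 + i + 1 by omega] at this) Q
    have hex : (ShortComplex.mk (C.d (m + 2) (m + 1)) (C.d (m + 1) m) (C.d_comp_d _ _ _)).Exact :=
      (HomologicalComplex.exactAt_iff' C (m + 2) (m + 1) m (by simp) (by simp)).1 (hC (m + 1))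
    -- By exactness the image already resolved is the kernel at the next spot, which is the
    -- left-hand term that `cons` requires.
    let R' := R.ofIso ((baseChangeFunctor k k' G).mapIso (imageIsoKernel hex))
    have hs := (hsplit m).baseChange k' hF
    have hp : IsFProjective F ((kernelImage (C.d (m + 1) m)).map (baseChangeFunctor k k' G)).X₂ :=
      hproj 0 (by omega)
    refine ⟨RelProjResolution.cons hs hp R', ?_⟩
    obtain ⟨e'⟩ := RelProjResolution.nonempty_cons_homology_iso hs hp R' M (l + j)
    have h₁ : l + 1 + (j + 1) = l + j + 2 := by omega
    have h₂ : l + j + 1 = l + 1 + j := by omega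
    rw [h₁]
    rw [h₂] at e'
    exact ⟨e' ≪≫ e⟩

lemma bot_mem_cyclicFamily (G : Type u) [Group G] : ⊥ ∈ (cyclicFamily G).carrier :=
  inferInstanceAs (IsCyclic (⊥ : Subgroup G))

/-- The contradiction needs only degree `1` at the left end: its cohomology vanishes, while shifting
by the `n + 1` permutation modules lands in degree `n + 2`, where the dimension `2n + 1` is
positive. -/
theorem not_hasPeriodicPermutationResolution :
    ¬ HasPeriodicPermutationResolution (cyclicFamily KleinFour) := by
  rintro ⟨n, X, _, C, hX, ⟨e₀⟩, hC, ⟨e₁⟩, hzero, hacyclic, hsplit⟩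
  let T := baseChangeFunctor ℤ (ZMod 2) KleinFour
  have hi₀ : image (C.d 1 0) ≅ C.X 0 := by
    have h := (HomologicalComplex.exactAt_iff' C 1 0 0 (by simp) (by simp)).1 (hacyclic 0)
    have : Epi (C.d 1 0) := (ShortComplex.exact_iff_epi _ (C.shape 0 0 (by simp))).1 h
    have : Epi (image.ι (C.d 1 0)) := epi_of_epi_fac (image.fac (C.d 1 0))
    have : IsIso (image.ι (C.d 1 0)) := isIso_of_mono_of_epi _
    exact asIso (image.ι (C.d 1 0))
  have hi₁ : C.X (n + 2) ≅ image (C.d (n + 2) (n + 1)) := by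
    have h := (HomologicalComplex.exactAt_iff' C (n + 3) (n + 2) (n + 1) (by simp) (by simp)).1
      (hacyclic (n + 2))
    have : Mono (C.d (n + 2) (n + 1)) :=
      (ShortComplex.exact_iff_mono _ ((hzero (n + 3) le_rfl).eq_of_src _ _)).1 h
    have : Mono (factorThruImage (C.d (n + 2) (n + 1))) :=
      mono_of_mono_fac (image.fac (C.d (n + 2) (n + 1)))
    have : IsIso (factorThruImage (C.d (n + 2) (n + 1))) := isIso_of_mono_of_epi _
    exact asIso (factorThruImage (C.d (n + 2) (n + 1)))
  -- The left-hand `ℤ` is the image of the last map into `C.X (n + 1)`; its reduction is resolved by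
  -- the join.
  let Q := joinResolution.ofIso ((baseChangeTrivialIso (k := ℤ) (ZMod 2)).symm ≪≫
    T.mapIso (e₁.symm ≪≫ hi₁))
  have hproj (i : ℕ) (hi : i < n + 1) :
      IsFProjective (cyclicFamily KleinFour) (T.obj (C.X (i + 1))) := by
    obtain ⟨e⟩ := hC ⟨i, hi⟩
    exact (isFProjective_ofMulAction _ (hX ⟨i, hi⟩)).of_iso
      ((baseChangeOfMulActionIso (k := ℤ) (ZMod 2) (X ⟨i, hi⟩)).symm ≪≫ (T.mapIso e).symm)
  obtain ⟨R, ⟨e⟩⟩ : ∃ R : RelProjResolution (cyclicFamily KleinFour)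
      (T.obj (image (C.d 1 0))), Nonempty
        ((R.complex.linearYonedaObj (ZMod 2) trivialF2).homology (0 + 1 + (n + 1)) ≅
          (Q.complex.linearYonedaObj (ZMod 2) trivialF2).homology (0 + 1)) := by
    have hs := exists_spliced_resolution (k' := ZMod 2) (bot_mem_cyclicFamily _) C hacyclic hsplit
      trivialF2 0 (n + 1) 0 (fun i hi => by rw [zero_add]; exact hproj i hi)
    rw [show 0 + (n + 1) = n + 1 by omega] at hs
    exact hs Q
  let R' := R.ofIso (T.mapIso (hi₀ ≪≫ e₀) ≪≫ baseChangeTrivialIso (k := ℤ) (ZMod 2))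
  have h := e.toLinearEquiv.finrank_eq
  have h₁ : Module.finrank (ZMod 2) ((Q.complex.linearYonedaObj (ZMod 2) trivialF2).homology
      (0 + 1)) = 0 := finrank_relCohomology_one joinResolution
  have h₂ := finrank_relCohomology_add_two R' n
  rw [h₁, show 0 + 1 + (n + 1) = n + 2 by omega] at h
  have h₃ := h₂.symm.trans h
  omega

end RelCohomology

/-! ### Ranks of the Klein four-group and of its subgroups -/

namespace RelCohomology

/-- The rank is the largest element of the defining set. -/
lemma isGreatest_groupRank {G : Type} [Group G] [Finite G] :
    IsGreatest {r | ∃ p : ℕ, p.Prime ∧ ∃ E : Subgroup G,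
      Nonempty (E ≃* Multiplicative (Fin r → ZMod p))} (groupRank G) := by
  have hb : BddAbove {r | ∃ p : ℕ, p.Prime ∧ ∃ E : Subgroup G,
      Nonempty (E ≃* Multiplicative (Fin r → ZMod p))} := by
    refine ⟨Nat.card G, ?_⟩
    rintro r ⟨p, hp, E, ⟨e⟩⟩
    have h : Nat.card E = p ^ r := by
      rw [Nat.card_congr e.toEquiv, Nat.card_congr Multiplicative.toAdd, Nat.card_fun]
      simp
    calc r ≤ p ^ r := (Nat.lt_pow_self hp.one_lt).le
      _ = Nat.card E := h.symm
      _ ≤ Nat.card G := E.card_le_card_group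
  have hne : {r | ∃ p : ℕ, p.Prime ∧ ∃ E : Subgroup G,
      Nonempty (E ≃* Multiplicative (Fin r → ZMod p))}.Nonempty :=
    ⟨0, 2, Nat.prime_two, ⊥, ⟨MulEquiv.ofUnique⟩⟩
  exact ⟨Nat.sSup_mem hne hb, fun r hr => le_csSup hb hr⟩

/-- The Klein four-group as a group of functions. -/
def kleinFourEquiv : KleinFour ≃* Multiplicative (Fin 2 → ZMod 2) where
  toFun g := .ofAdd ![g.1.toAdd, g.2.toAdd]
  invFun f := (.ofAdd (f.toAdd 0), .ofAdd (f.toAdd 1))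
  left_inv g := rfl
  right_inv f := by
    refine congrArg Multiplicative.ofAdd ?_
    funext i
    fin_cases i <;> rfl
  map_mul' g h := by
    refine congrArg Multiplicative.ofAdd ?_
    funext i
    fin_cases i <;> rfl

lemma isCyclic_of_ne_top {H : Subgroup KleinFour} (hH : H ≠ ⊤) : IsCyclic H := by
  have hcard : Nat.card KleinFour = 4 := by
    rw [Nat.card_eq_fintype_card]; rfl
  have hdvd : Nat.card H ∣ 4 := hcard ▸ H.card_subgroup_dvd_card
  have hne : Nat.card H ≠ 4 := fun h => hH (Subgroup.eq_top_of_card_eq H (h.trans hcard.symm))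
  have hle : Nat.card H ≤ 4 := Nat.le_of_dvd (by norm_num) hdvd
  have hpos : 0 < Nat.card H := Nat.card_pos
  have h : Nat.card H = 1 ∨ Nat.card H = 2 := by
    interval_cases Nat.card H <;> simp_all
  rcases h with h | h
  · have : Subsingleton H := (Nat.card_eq_one_iff_unique.1 h).1
    exact isCyclic_of_subsingleton
  · have : Fact (Nat.Prime 2) := ⟨Nat.prime_two⟩
    exact isCyclic_of_prime_card h

/-- A generator of a cyclic group of exponent dividing `p` has order at most `p`, which is less than
`p ^ r` for `r > 1`. -/
lemma groupRank_le_one_of_isCyclic {G : Type} [Group G] [Finite G] (hG : IsCyclic G) :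
    groupRank G ≤ 1 := by
  obtain ⟨p, hp, E, ⟨e⟩⟩ := (isGreatest_groupRank (G := G)).1
  have : Fact p.Prime := ⟨hp⟩
  have hE : IsCyclic (Multiplicative (Fin (groupRank G) → ZMod p)) :=
    isCyclic_of_surjective e e.surjective
  by_contra! hr
  obtain ⟨g, hg⟩ := hE.exists_ofOrder_eq_natCard
  have hp' : g ^ p = 1 := by
    refine congrArg Multiplicative.ofAdd (?_ : p • g.toAdd = 0)
    funext i
    simp
  have hle : orderOf g ≤ p := orderOf_le_of_pow_eq_one hp.pos hp'
  rw [hg, Nat.card_congr Multiplicative.toAdd, Nat.card_fun, Nat.card_zmod,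
    Nat.card_eq_fintype_card, Fintype.card_fin] at hle
  have := (pow_one p).symm.trans_lt (Nat.pow_lt_pow_right hp.one_lt hr)
  omega

lemma groupRank_kleinFour : groupRank KleinFour = 2 := by
  have h := isGreatest_groupRank (G := KleinFour)
  refine le_antisymm ?_ (h.2 ⟨2, Nat.prime_two, ⊤, ⟨Subgroup.topEquiv.trans kleinFourEquiv⟩⟩)
  obtain ⟨p, hp, E, ⟨e⟩⟩ := h.1
  have hE : Nat.card E = p ^ groupRank KleinFour := by
    rw [Nat.card_congr e.toEquiv, Nat.card_congr Multiplicative.toAdd, Nat.card_fun]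
    simp
  have hcard : Nat.card KleinFour = 4 := by
    rw [Nat.card_eq_fintype_card]; rfl
  have hle : 2 ^ groupRank KleinFour ≤ 2 ^ 2 :=
    calc 2 ^ groupRank KleinFour ≤ p ^ groupRank KleinFour := Nat.pow_le_pow_left hp.two_le _
      _ = Nat.card E := hE.symm
      _ ≤ Nat.card KleinFour := E.card_le_card_group
      _ = 2 ^ 2 := hcard
  exact (Nat.pow_le_pow_iff_right (by norm_num)).1 hle

lemma mem_cyclicFamily_iff_groupRank_le_one (H : Subgroup KleinFour) :
    H ∈ (cyclicFamily KleinFour).carrier ↔ groupRank H ≤ 1 := by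
  refine ⟨groupRank_le_one_of_isCyclic, fun h => isCyclic_of_ne_top ?_⟩
  rintro rfl
  have : 2 ≤ groupRank (⊤ : Subgroup KleinFour) :=
    isGreatest_groupRank.2 ⟨2, Nat.prime_two, ⊤,
      ⟨Subgroup.topEquiv.trans (Subgroup.topEquiv.trans kleinFourEquiv)⟩⟩
  omega

end RelCohomology

theorem theorem1p2 :
    -- relative cohomology is computed from relative projective resolutions, which exist
    Nonempty (RelCohomology.RelProjResolution
      (RelCohomology.cyclicFamily RelCohomology.KleinFour)
      (Rep.trivial (ZMod 2) RelCohomology.KleinFour (ZMod 2))) ∧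
    -- dimensions and non-periodicity, for any relative projective resolution
    (∀ P : RelCohomology.RelProjResolution
        (RelCohomology.cyclicFamily RelCohomology.KleinFour)
        (Rep.trivial (ZMod 2) RelCohomology.KleinFour (ZMod 2)),
      (∀ n, Module.Finite (ZMod 2) (RelCohomology.relCohomology P
        (Rep.trivial (ZMod 2) RelCohomology.KleinFour (ZMod 2)) n)) ∧
      Module.finrank (ZMod 2) (RelCohomology.relCohomology P
        (Rep.trivial (ZMod 2) RelCohomology.KleinFour (ZMod 2)) 0) = 1 ∧
      Module.finrank (ZMod 2) (RelCohomology.relCohomology P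
        (Rep.trivial (ZMod 2) RelCohomology.KleinFour (ZMod 2)) 1) = 0 ∧
      (∀ n, 2 ≤ n → Module.finrank (ZMod 2) (RelCohomology.relCohomology P
        (Rep.trivial (ZMod 2) RelCohomology.KleinFour (ZMod 2)) n) = 2 * n - 3) ∧
      ¬ RelCohomology.IsPeriodic (RelCohomology.relCohomology P
        (Rep.trivial (ZMod 2) RelCohomology.KleinFour (ZMod 2)))) ∧
    -- the group has rank two, and the family consists of the subgroups of rank at most one
    RelCohomology.groupRank RelCohomology.KleinFour = 2 ∧
    (∀ H : Subgroup RelCohomology.KleinFour,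
      H ∈ (RelCohomology.cyclicFamily RelCohomology.KleinFour).carrier ↔
        RelCohomology.groupRank H ≤ 1) ∧
    -- the rank question has a negative answer
    ¬ RelCohomology.HasPeriodicPermutationResolution
      (RelCohomology.cyclicFamily RelCohomology.KleinFour) := by
  refine ⟨⟨RelCohomology.joinResolution⟩, fun P => ⟨RelCohomology.finite_relCohomology P,
    RelCohomology.finrank_relCohomology_zero P, RelCohomology.finrank_relCohomology_one P,
    fun n hn => ?_, RelCohomology.not_isPeriodic_relCohomology P⟩,
    RelCohomology.groupRank_kleinFour, RelCohomology.mem_cyclicFamily_iff_groupRank_le_one,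
    RelCohomology.not_hasPeriodicPermutationResolution⟩
  -- With `n = m + 2` the truncated subtraction `2 * n - 3` is the true value `2 * m + 1`.
  obtain ⟨m, rfl⟩ : ∃ m, n = m + 2 := ⟨n - 2, by omega⟩
  rw [RelCohomology.finrank_relCohomology_add_two P m]
  omega
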